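/- Let $A$ be a finite alphabet and work over $\mathbb{Q}$. A \emph{sentence} $I=(w_1,\dots,w_k)$ is a finite sequence of non-empty words over $A$; $\ell(I)=k$, $|I|=\sum_i|w_i|$, $w(I)=w_1\cdots w_k$ and $I^r=(w_k,\dots,w_1)$. Write $I\preceq J$ if $J$ arises from $I$ by concatenating some adjacent words. Let $NSym_A$ be the free associative algebra on generators $H_w$ ($w$ a non-empty word), with basis $H_I=H_{w_1}\cdots H_{w_k}$ (and $H_\emptyset=1$), and let $R_I=\sum_{J\succeq I}(-1)^{\ell(J)-\ell(I)}H_J$ be the colored ribbon functions. Take variables $x_{a,i}$ ($a\in A$, $i\ge 1$) that commute when their second indices are different and not otherwise, put $x_{w,i}=x_{a_1,i}\cdots x_{a_m,i}$ for $w=a_1\cdots a_m$, and let $M_I=\sum_{j_1<\dots<j_k}x_{w_1,j_1}\cdots x_{w_k,j_k}$; these formal series span the algebra $QSym_A$, which is paired with $NSym_A$ by $\langle H_I,M_J\rangle=\delta_{I,J}$. For $G\in QSym_A$ let $G^{\perp}$ be the operator on $NSym_A$ with $\langle G^{\perp}F,G'\rangle=\langle F,G'G\rangle$ for all $G'\in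 QSym_A$. For a word $v$ let $$\mathbb{B}_v=\sum_{u}\ \sum_{Q:\,w(Q^r)=u}(-1)^{\ell(Q)}H_{v\cdot u}\Big(\sum_{S\succeq Q}M_S^{\perp}\Big),$$ where $u$ runs over words and $Q,S$ over sentences. The \emph{colored immaculate function} of $J=(v_1,\dots,v_h)$ is $\mathfrak{S}_J=\mathbb{B}_{v_1}\cdots\mathbb{B}_{v_h}(1)$. A \emph{standard colored immaculate tableau} of shape $J=(v_1,\dots,v_h)$ is a filling with $1,\dots,|J|$, each used once, of the left-justified diagram whose $i$-th row from the top has $|v_i|$ boxes, the $j$-th of them colored with the $j$-th letter of $v_i$, such that rows increase from left to right and the first column increases from top to bottom. Its \emph{colored descent composition} is the sentence obtained by reading the colors of the boxes in the order of their numbers and starting a new word each time the next box is in a strictly lower row. Let $L_{J,C}$ be the number of standard colored immaculate tableaux of shape $J$ with colored descent composition $C$. Let $\mathfrak{D}^n_A$ be the directed graph on the sentences of size $n$ with an edge $I\to J$ ($I\ne J$) of weight $L_{I,J}$ whenever $L_{I,J}\neq0$. For a directed path $\mathcal{P}$, let $\ell(\mathcal{P})$ be its number of edges and $prod(\mathcal{P})$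 the product of the weights of its edges ($1$ for the empty path). \textbf{Theorem.} For every $n\ge0$ the matrix $L=(L_{I,J})_{|I|=|J|=n}$ is invertible, and for all sentences $I,J$ of size $n$ its inverse has the entry $$L^{-1}_{I,J}=\sum_{\mathcal{P}}(-1)^{\ell(\mathcal{P})}prod(\mathcal{P}),$$ where the sum is over the directed paths $\mathcal{P}$ from $I$ to $J$ in $\mathfrak{D}^n_A$. For every sentence $J$ of size $n$, the colored immaculate function expands into colored ribbon functions as $$\mathfrak{S}_J=\sum_{|I|=n}L^{-1}_{I,J}R_I,$$ and for every sentence $C$ of size $n$, $$R_C=\sum_{|J|=n}L_{J,C}\,\mathfrak{S}_J.$$ -/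

import Mathlib

namespace ColoredImm

/-! ### Words and sentences over an alphabet `A` -/

/-- Non-empty words over the alphabet `A`. -/
abbrev NWord (A : Type*) := {w : List A // w ≠ []}

/-- Sentences over `A`: finite sequences of non-empty words. -/
abbrev Sentence (A : Type*) := List (NWord A)

/-- The maximal word `w(I)`: the concatenation of all words of `I`. -/
def maxWord {A : Type*} (I : Sentence A) : List A := (I.map Subtype.val).flatten

/-- The size `|I|`: the number of colors (with repetition) in `I`. -/
def size {A : Type*} (I : Sentence A) : ℕ := (I.map fun w => w.1.length).sum

/-- `I ≼ J`: the sentence `J` is obtained from `I` by concatenating some adjacent words, i.e. `I`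
can be cut into consecutive blocks whose concatenations are the words of `J`. -/
def Refines {A : Type*} (I J : Sentence A) : Prop :=
  ∃ blocks : List (Sentence A), blocks.flatten = I ∧ blocks.map maxWord = J.map Subtype.val

theorem finite_maxWord_eq {A : Type*} (w : List A) : {S : Sentence A | maxWord S = w}.Finite := by
  have hfin : (Set.range fun c : Composition w.length => c.blocks).Finite := Set.finite_range _
  refine Set.Finite.of_finite_image (f := fun S : Sentence A => S.map fun u => u.1.length)
    (hfin.subset ?_) ?_
  · rintro _ ⟨S, rfl, rfl⟩
    refine ⟨⟨S.map fun u => u.1.length, ?_, ?_⟩, rfl⟩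
    · intro i hi
      obtain ⟨u, -, rfl⟩ := List.mem_map.1 hi
      exact List.length_pos_of_ne_nil u.2
    · simp [maxWord, List.length_flatten]
  · intro S hS T hT h
    refine List.map_injective_iff.2 Subtype.val_injective (List.eq_iff_flatten_eq.2 ⟨?_, ?_⟩)
    · exact Eq.trans hS (Eq.symm hT)
    · simpa [List.map_map, Function.comp_def] using h

theorem Refines.maxWord_eq {A : Type*} {I J : Sentence A} (h : Refines I J) :
    maxWord J = maxWord I := by
  obtain ⟨b, rfl, hb⟩ := h
  have : (b.map maxWord).flatten = maxWord b.flatten := by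
    clear hb
    induction b with
    | nil => rfl
    | cons x xs ih =>
      rw [List.map_cons, List.flatten_cons, ih]
      simp [maxWord]
  rw [← this, hb]; rfl

theorem finite_coarsenings {A : Type*} (Q : Sentence A) : {S : Sentence A | Refines Q S}.Finite :=
  (finite_maxWord_eq (maxWord Q)).subset fun _ h => Refines.maxWord_eq h

/-- The finite set of coarsenings `S ≽ Q` of a sentence `Q`. -/
noncomputable def coarsenings {A : Type*} (Q : Sentence A) : Finset (Sentence A) :=
  (finite_coarsenings Q).toFinset

/-- Sentences of size `n`. -/
abbrev SentenceOf (A : Type*) (n : ℕ) := {I : Sentence A // size I = n}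

theorem finite_sentenceOf (A : Type*) [Finite A] (n : ℕ) : {I : Sentence A | size I = n}.Finite := by
  have h : (⋃ w ∈ {w : List A | w.length = n}, {S : Sentence A | maxWord S = w}).Finite :=
    Set.Finite.biUnion (List.finite_length_eq A n) fun w _ => finite_maxWord_eq w
  refine h.subset fun I hI => ?_
  simp only [Set.mem_iUnion, Set.mem_ofPred_eq, exists_prop, exists_eq_right']
  rw [← show size I = n from hI]
  simp [maxWord, size, List.length_flatten]

noncomputable instance instFintypeSentenceOf (A : Type*) [Finite A] (n : ℕ) :
    Fintype (SentenceOf A n) :=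
  (finite_sentenceOf A n).fintype

/-! ### Colored noncommutative symmetric functions -/

/-- `NSym_A`: the free associative `ℚ`-algebra on generators `H_w`, `w` a non-empty word; that is,
the `ℚ`-algebra with linear basis the sentences, multiplied by concatenation. -/
abbrev NSym (A : Type*) := MonoidAlgebra ℚ (FreeMonoid (NWord A))

/-- The colored complete homogeneous function `H_I`. -/
noncomputable def H {A : Type*} (I : Sentence A) : NSym A :=
  MonoidAlgebra.single (FreeMonoid.ofList I) 1

open Classical in
/-- `H_w` for a single, possibly empty, word `w`; `H_∅ = 1`. -/
noncomputable def hWord {A : Type*} (w : List A) : NSym A :=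
  if h : w = [] then 1 else H [⟨w, h⟩]

/-- The colored ribbon function `R_I = ∑_{J ≽ I} (-1)^{ℓ(J) - ℓ(I)} H_J`. -/
noncomputable def R {A : Type*} (I : Sentence A) : NSym A :=
  ∑ J ∈ coarsenings I, (-1 : ℚ) ^ ((J.length : ℤ) - (I.length : ℤ)) • H J

/-! ### Power series in the partially commutative variables `x_{a,i}`

Variables `x_{a,i}` and `x_{b,j}` commute exactly when `i ≠ j` (or they are equal), so a monomial
is the same as a finitely supported family of words, one for each second index `i`, multiplied
index by index.  The second indices are numbered from `0` instead of from `1`. -/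

/-- The monoid of monomials in the variables `x_{a,i}`. -/
def monomials (A : Type*) : Submonoid (ℕ → FreeMonoid A) where
  carrier := {m | (Function.mulSupport m).Finite}
  one_mem' := by simp
  mul_mem' := fun {a b} ha hb => (ha.union hb).subset (Function.mulSupport_mul a b)

/-- The monomial `x_{w,j} = x_{a_1,j} ⋯ x_{a_k,j}` for a word `w = a_1 ⋯ a_k`. -/
def xWord {A : Type*} (w : List A) (j : ℕ) : monomials A :=
  ⟨Pi.mulSingle j (FreeMonoid.ofList w),
    (Set.finite_singleton j).subset Pi.mulSupport_mulSingle_subset⟩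

/-- The monomial `x_{w_1,j_1} ⋯ x_{w_k,j_k}` for `I = (w_1, …, w_k)` and indices `j_1, …, j_k`. -/
def xSentence {A : Type*} (I : Sentence A) (j : Fin I.length → ℕ) : monomials A :=
  (List.ofFn fun t => xWord (I.get t).1 (j t)).prod

/-- Formal power series over `ℚ` in the variables `x_{a,i}`, given by their coefficients. -/
abbrev Series (A : Type*) := monomials A → ℚ

/-- The product of two power series. Every monomial has finitely many factorizations. -/
noncomputable def Series.times {A : Type*} (f g : Series A) : Series A := fun m =>
  ∑ᶠ p ∈ {p : monomials A × monomials A | p.1 * p.2 = m}, f p.1 * g p.2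

/-- The colored monomial quasisymmetric function
`M_I = ∑_{j_1 < ⋯ < j_k} x_{w_1,j_1} ⋯ x_{w_k,j_k}`: the coefficient of a monomial is the number of
index sequences that produce it. -/
noncomputable def M {A : Type*} (I : Sentence A) : Series A := fun m =>
  (Nat.card {j : Fin I.length ↪o ℕ // xSentence I j = m} : ℚ)

/-- The pairing `⟨F, G⟩` of `F ∈ NSym_A` and `G ∈ QSym_A` determined by `⟨H_I, M_J⟩ = δ_{I,J}`:
`⟨H_I, G⟩` is the coefficient of `M_I` in the colored quasisymmetric function `G`, which is the
coefficient in `G` of the monomial `x_{w_1,1} ⋯ x_{w_k,k}`, `I = (w_1, …, w_k)`. -/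
noncomputable def pairing {A : Type*} (F : NSym A) (G : Series A) : ℚ :=
  F.coeff.sum fun I c => c * G (xSentence (FreeMonoid.toList I) fun t => (t : ℕ))

/-- The right perp operator of `G ∈ QSym_A`, adjoint to right multiplication by `G`:
`F ↦ ∑_I ⟨F, M_I G⟩ H_I` (only finitely many terms are non-zero). -/
noncomputable def rperp {A : Type*} (G : Series A) (F : NSym A) : NSym A :=
  ∑ᶠ I : Sentence A, pairing F ((M I).times G) • H I

/-! ### Colored immaculate functions -/

/-- The colored noncommutative Bernstein operator
`𝔹_v = ∑_u ∑_{w(Qʳ) = u} (-1)^{ℓ(Q)} H_{v·u} (∑_{S ≽ Q} M_S^⊥)`, with `⊥` the right perp operator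
and `Qʳ` the sentence `Q` with the order of its words reversed. The double sum over `u` and `Q` is a
sum over all sentences `Q`, with `u = w(Qʳ)`; on each element only finitely many terms are
non-zero. -/
noncomputable def bernstein {A : Type*} (v : List A) (F : NSym A) : NSym A :=
  ∑ᶠ Q : Sentence A, (-1 : ℚ) ^ Q.length •
    (hWord (v ++ maxWord Q.reverse) * ∑ S ∈ coarsenings Q, rperp (M S) F)

/-- The colored immaculate function `𝔖_J = 𝔹_{v_1} 𝔹_{v_2} ⋯ 𝔹_{v_h} (1)`,
`J = (v_1, …, v_h)`. -/
noncomputable def immaculate {A : Type*} (J : Sentence A) : NSym A :=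
  J.foldr (fun v F => bernstein v.1 F) 1

/-! ### Standard colored immaculate tableaux -/

/-- The boxes of the colored composition diagram of shape `J`: pairs of a row `c.1` (rows are
numbered from top to bottom) and a column `c.2`, both numbered from `0`. -/
abbrev Box {A : Type*} (J : Sentence A) := (i : Fin J.length) × Fin (J.get i).1.length

/-- The color of a box. -/
def Box.color {A : Type*} {J : Sentence A} (c : Box J) : A := (J.get c.1).1.get c.2

/-- Colored immaculate tableaux of shape `J`. -/
structure CIT {A : Type*} (J : Sentence A) where
  entry : Box J → ℕ
  entry_pos : ∀ c, 0 < entry c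
  row_weak : ∀ c d : Box J, c.1 = d.1 → (c.2 : ℕ) ≤ (d.2 : ℕ) → entry c ≤ entry d
  col_strict : ∀ c d : Box J, (c.2 : ℕ) = 0 → (d.2 : ℕ) = 0 → c.1 < d.1 → entry c < entry d

/-- Standard colored immaculate tableaux of shape `J`: each of `1, …, |J|` appears exactly once. -/
structure SCIT {A : Type*} (J : Sentence A) extends CIT J where
  standard : ∀ k : ℕ, 1 ≤ k → k ≤ size J → ∃! c, entry c = k

/-- The box of `T` with entry `k + 1`. -/
noncomputable def SCIT.box {A : Type*} {J : Sentence A} (T : SCIT J) (k : Fin (size J)) : Box J :=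
  (T.standard (k + 1) (by omega) (by omega)).exists.choose

/-- The boxes in the order in which they are numbered, cut into blocks after each descent, i.e.
whenever the next box is in a strictly lower row. -/
noncomputable def SCIT.blocks {A : Type*} {J : Sentence A} (T : SCIT J) : List (List (Box J)) :=
  (List.ofFn T.box).splitBy fun c d => decide (d.1 ≤ c.1)

/-- The colored descent composition `co_A(T)`: the sentence obtained by reading the colors of the
boxes in the order in which they are numbered and starting a new word after each descent. -/
noncomputable def SCIT.descentComposition {A : Type*} {J : Sentence A} (T : SCIT J) : Sentence A :=
  T.blocks.attach.map fun b =>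
    ⟨b.1.map Box.color, by simpa using List.ne_nil_of_mem_splitBy b.2⟩

/-- `L_{J,C}`: the number of standard colored immaculate tableaux of shape `J` with colored descent
composition `C`. -/
noncomputable def L {A : Type*} (J C : Sentence A) : ℕ :=
  Nat.card {T : SCIT J // T.descentComposition = C}

/-- The matrix `(L_{J,C})`, indexed by sentences of size `n`. -/
noncomputable def matL (A : Type*) (n : ℕ) : Matrix (SentenceOf A n) (SentenceOf A n) ℚ :=
  Matrix.of fun J C => (L J.1 C.1 : ℚ)

/-! ### The colored immaculate descent graph -/

/-- The colored immaculate descent graph `𝔇ⁿ_A` (without loops); the edge `I → J` has weight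
`L_{I,J}`. -/
def descentGraph (A : Type*) (n : ℕ) : Digraph (SentenceOf A n) where
  Adj I J := I ≠ J ∧ ∃ T : SCIT I.1, T.descentComposition = J.1

/-- The list `p` of vertices is a directed path from `I` to `J` in `𝔇ⁿ_A`. The empty path at `I` is
the list `[I]`. -/
structure IsPath {A : Type*} {n : ℕ} (I J : SentenceOf A n) (p : List (SentenceOf A n)) : Prop where
  chain : p.IsChain (descentGraph A n).Adj
  nodup : p.Nodup
  head_eq : p.head? = some I
  last_eq : p.getLast? = some J

theorem finite_paths {A : Type*} [Finite A] {n : ℕ} (I J : SentenceOf A n) :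
    {p | IsPath I J p}.Finite := by
  classical
  have h : Finite {p : List (SentenceOf A n) // p.Nodup} := inferInstance
  exact (Set.finite_coe_iff.1 h).subset fun _ h => h.nodup

/-- The finite set of directed paths from `I` to `J` in `𝔇ⁿ_A`. -/
noncomputable def paths {A : Type*} [Finite A] {n : ℕ} (I J : SentenceOf A n) :
    Finset (List (SentenceOf A n)) :=
  (finite_paths I J).toFinset

/-- The length `ℓ(P)` of a path: its number of edges. -/
def pathLength {A : Type*} {n : ℕ} (p : List (SentenceOf A n)) : ℕ := p.length - 1

/-- `prod(P)`: the product of the weights of the edges of a path. -/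
noncomputable def pathProd {A : Type*} {n : ℕ} (p : List (SentenceOf A n)) : ℕ :=
  (List.zipWith (fun I J => L I.1 J.1) p p.tail).prod

/-- `∑_P (-1)^{ℓ(P)} prod(P)` over the directed paths `P` from `I` to `J` in `𝔇ⁿ_A`. -/
noncomputable def signedPathSum {A : Type*} [Finite A] {n : ℕ} (I J : SentenceOf A n) : ℚ :=
  ∑ p ∈ paths I J, (-1 : ℚ) ^ pathLength p * (pathProd p : ℚ)

end ColoredImm

/-!
The matrix `L` is unitriangular with respect to `weight J = ∑ i * |v_i|`, the sum of the row numbers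
of the boxes of `J`: in a standard colored immaculate tableau a new row can only start right after a
descent, so the boxes of the `t`-th run lie in the first `t` rows, and only the tableau filled row
by row attains the bound (`growthSet_weight`). Hence every edge of the descent graph increases the
weight, and splitting off the first edge of a path (`signedPathSum_eq`) shows that the signed path
sums form a right inverse of `L`. It remains to prove `R_C = ∑_J L_{J,C} 𝔖_J`; the expansion of
`𝔖_J` follows by inverting `L`.

For the Bernstein operators, `M_S^⊥ H_K` is the sum, over all ways of cutting each word of `K` into
a prefix and a suffix such that the non-empty suffixes form `S`, of `H` of the non-empty prefixes
(`rperp_M`). Summing over the refinements `Q` of `S` replaces a suffix `b` by its antipode `alt b`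
in the free algebra on the letters, and `𝔹_v` becomes the operator `bernLin` of the word `v`, where
`bernLin p` is linear in the element `p` of the free algebra (`bernstein_eq_bernLin`). It satisfies
`bernLin p (F H_w) = ∑_{w = ab} bernLin (p * alt b) F * H_a`; inverting this relation with the
antipode identity gives `𝔹_v(F) H_w = ∑_{w = ab} 𝔹_{vb}(F H_a)` (`bernstein_mul_hWord`), and, by
induction on the number of rows, a right Pieri rule (`immaculate_mul_hWord`): `𝔖_J H_w` is the sum
of the `𝔖` of all shapes obtained from `J` by adding boxes that spell `w` and never step down.

A standard tableau is recorded by the rows and colors of its boxes in the order of their numbers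
(`L_eq_card`). Let `X_C` be the sum of the `𝔖` of the shapes of all such sequences with descent
composition `C`. By the Pieri rule, appending a strip `w` to a sequence whose composition ends with
`c` gives `X_{(…,c)} H_w = X_{(…,c,w)} + X_{(…,cw)}`, according to whether the strip starts with a
descent. The ribbon functions satisfy the same recursion (`R_concat_mul_H`), so `R_C = X_C`
(`R_eq_sum_growthSet`).
-/

namespace ColoredImm

variable {A : Type*}

/-! ### Cutting words and lists of words in two -/

/-- The pairs `(a, b)` of possibly empty words with `a ++ b = w`. -/
def splits (w : List A) : Finset (List A × List A) :=
  ⟨(List.range (w.length + 1)).map fun i => (w.take i, w.drop i), by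
    refine Multiset.coe_nodup.2 (List.Nodup.map_on ?_ List.nodup_range)
    intro i hi j hj h
    have := congrArg (fun p : List A × List A => p.1.length) h
    simp at this hi hj
    omega⟩

@[simp] theorem mem_splits {w : List A} {p : List A × List A} : p ∈ splits w ↔ p.1 ++ p.2 = w := by
  rcases p with ⟨a, b⟩
  simp only [splits, Finset.mem_mk, Multiset.mem_coe, List.mem_map, List.mem_range, Prod.mk.injEq]
  constructor
  · rintro ⟨i, -, rfl, rfl⟩
    exact List.take_append_drop i w
  · rintro rfl
    exact ⟨a.length, by simp, by simp, by simp⟩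

@[simp] theorem splits_nil : splits ([] : List A) = {([], [])} := by
  ext ⟨a, b⟩; simp

theorem finite_allSplits (l : List (List A)) :
    {x : List (List A × List A) | x.map (fun p => p.1 ++ p.2) = l}.Finite := by
  induction l with
  | nil => simp
  | cons w l ih =>
    refine (Set.Finite.image2 List.cons (splits w).finite_toSet ih).subset ?_
    rintro (_ | ⟨p, x⟩) h
    · simp at h
    · simp only [Set.mem_ofPred_eq, List.map_cons, List.cons.injEq] at h
      exact ⟨p, by simpa using h.1, x, h.2, rfl⟩

/-- All ways of cutting every word of the list `l` in two. -/
noncomputable def allSplits (l : List (List A)) : Finset (List (List A × List A)) :=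
  (finite_allSplits l).toFinset

@[simp] theorem mem_allSplits {l : List (List A)} {x : List (List A × List A)} :
    x ∈ allSplits l ↔ x.map (fun p => p.1 ++ p.2) = l := by
  simp [allSplits]

@[simp] theorem allSplits_nil : allSplits ([] : List (List A)) = {[]} := by
  ext x; simp

theorem sum_allSplits_concat {N : Type*} [AddCommMonoid N] (l : List (List A)) (w : List A)
    (f : List (List A × List A) → N) :
    ∑ x ∈ allSplits (l ++ [w]), f x = ∑ x ∈ allSplits l, ∑ p ∈ splits w, f (x ++ [p]) := by
  rw [← Finset.sum_product']
  symm
  refine Finset.sum_nbij (fun y => y.1 ++ [y.2]) ?_ ?_ ?_ fun _ _ => rfl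
  · rintro ⟨x, p⟩ h
    simpa using h
  · rintro ⟨x, p⟩ - ⟨y, q⟩ - h
    simpa using h
  · intro z hz
    simp only [SetLike.mem_coe, mem_allSplits] at hz
    rcases List.eq_nil_or_concat z with rfl | ⟨y, q, rfl⟩
    · simp at hz
    · rw [List.concat_eq_append, List.map_append, List.map_singleton] at hz
      have := List.append_inj' hz rfl
      refine ⟨(y, q), by simpa using this, by simp⟩

/-- The sentence of the non-empty words of a list of words. -/
noncomputable def strip (l : List (List A)) : Sentence A :=
  open Classical in l.filterMap fun w => if h : w = [] then none else some ⟨w, h⟩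

@[simp] theorem strip_nil : strip ([] : List (List A)) = [] := rfl

@[simp] theorem strip_nil_cons (l : List (List A)) : strip ([] :: l) = strip l := by
  simp [strip]

theorem strip_cons_of_ne {w : List A} (h : w ≠ []) (l : List (List A)) :
    strip (w :: l) = ⟨w, h⟩ :: strip l := by
  simp [strip, h]

theorem strip_append (l l' : List (List A)) : strip (l ++ l') = strip l ++ strip l' := by
  simp [strip, List.filterMap_append]

/-! ### Coefficients of the monomial quasisymmetric functions -/

/-- The monomial `x_{w_0,0} x_{w_1,1} ⋯` of a list of possibly empty words. -/
def mono (l : List (List A)) : monomials A :=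
  ⟨fun i => FreeMonoid.ofList (l.getD i []), (Set.finite_lt_nat l.length).subset fun i hi => by
    by_contra h
    exact hi (by simp [List.getElem?_eq_none (not_lt.1 h)])⟩

theorem mono_apply (l : List (List A)) (i : ℕ) :
    (mono l).1 i = FreeMonoid.ofList (l.getD i []) := rfl

theorem xSentence_nil (j : Fin ([] : Sentence A).length → ℕ) : xSentence [] j = 1 := by
  simp [xSentence]

theorem xSentence_cons (w : NWord A) (I : Sentence A) (j : Fin (w :: I).length → ℕ) :
    xSentence (w :: I) j = xWord w.1 (j 0) * xSentence I fun t => j t.succ := by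
  simp [xSentence, List.ofFn_succ]

theorem xSentence_apply_of_forall_ne (I : Sentence A) (j : Fin I.length → ℕ) (i : ℕ)
    (h : ∀ t, j t ≠ i) : (xSentence I j).1 i = 1 := by
  induction I with
  | nil => simp [xSentence_nil]
  | cons w I ih =>
    rw [xSentence_cons, Submonoid.coe_mul, Pi.mul_apply, ih _ fun t => h _, mul_one]
    exact Pi.mulSingle_eq_of_ne (h 0).symm _

theorem xSentence_apply (I : Sentence A) (j : Fin I.length → ℕ) (hj : Function.Injective j)
    (t : Fin I.length) : (xSentence I j).1 (j t) = FreeMonoid.ofList (I.get t).1 := by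
  induction I with
  | nil => exact t.elim0
  | cons w I ih =>
    rw [xSentence_cons, Submonoid.coe_mul, Pi.mul_apply]
    refine Fin.cases ?_ (fun t => ?_) t
    · rw [xSentence_apply_of_forall_ne _ _ _ fun t => hj.ne (Fin.succ_ne_zero t), mul_one]
      exact Pi.mulSingle_eq_same _ _
    · rw [ih (fun t => j t.succ) (hj.comp (Fin.succ_injective _)) t]
      refine (congrArg (· * _) (Pi.mulSingle_eq_of_ne (hj.ne (Fin.succ_ne_zero t)) _)).trans ?_
      simp

theorem xSentence_apply_ne_one (I : Sentence A) (j : Fin I.length → ℕ) (hj : Function.Injective j)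
    (i : ℕ) : (xSentence I j).1 i ≠ 1 ↔ ∃ t, j t = i := by
  constructor
  · intro h
    by_contra! h'
    exact h (xSentence_apply_of_forall_ne I j i h')
  · rintro ⟨t, rfl⟩
    rw [xSentence_apply I j hj]
    exact (I.get t).2

theorem xSentence_coe (I : Sentence A) :
    (xSentence I fun t => (t : ℕ)) = mono (I.map Subtype.val) := by
  refine Subtype.ext (funext fun i => ?_)
  rw [mono_apply]
  by_cases h : i < I.length
  · rw [xSentence_apply I (fun t => (t : ℕ)) Fin.val_injective ⟨i, h⟩]
    simp [h]
  · rw [xSentence_apply_of_forall_ne _ _ _ fun t (ht : (t : ℕ) = i) => h (ht ▸ t.2)]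
    simp [List.getElem?_eq_none (not_lt.1 h)]

/-- The sentence and the indices can be recovered from a monomial. -/
theorem xSentence_inj {I I' : Sentence A} {j : Fin I.length → ℕ} {j' : Fin I'.length → ℕ}
    (hj : StrictMono j) (hj' : StrictMono j') (h : xSentence I j = xSentence I' j') :
    I = I' ∧ List.ofFn j = List.ofFn j' := by
  have hs : List.ofFn j = List.ofFn j' := by
    refine (List.sortedLT_ofFn_iff.2 hj).eq_of_mem_iff (List.sortedLT_ofFn_iff.2 hj') fun i => ?_
    rw [List.mem_ofFn', List.mem_ofFn', Set.mem_range, Set.mem_range,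
      ← xSentence_apply_ne_one I j hj.injective, ← xSentence_apply_ne_one I' j' hj'.injective, h]
  refine ⟨?_, hs⟩
  have key : ∀ (I : Sentence A) (j : Fin I.length → ℕ), StrictMono j →
      (List.ofFn j).map (xSentence I j).1 = I.map fun w => FreeMonoid.ofList w.1 := by
    intro I j hj
    refine List.ext_getElem (by simp) fun n h1 h2 => ?_
    simpa using xSentence_apply I j hj.injective ⟨n, by simpa using h1⟩
  have := key I j hj
  rw [hs, h, key I' j' hj'] at this
  exact (List.map_injective_iff.2 Subtype.val_injective this).symm

theorem exists_xSentence_strip (l : List (List A)) :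
    ∃ j : Fin (strip l).length → ℕ, StrictMono j ∧ xSentence (strip l) j = mono l := by
  suffices h : ∃ j : Fin (strip l).length → ℕ, StrictMono j ∧
      (∀ t, l.getD (j t) [] = ((strip l).get t).1) ∧ ∀ i, (∀ t, j t ≠ i) → l.getD i [] = [] by
    obtain ⟨j, hj, h1, h2⟩ := h
    refine ⟨j, hj, Subtype.ext (funext fun i => ?_)⟩
    by_cases hi : ∃ t, j t = i
    · obtain ⟨t, rfl⟩ := hi
      rw [xSentence_apply _ _ hj.injective, mono_apply, h1]
    · push Not at hi
      rw [xSentence_apply_of_forall_ne _ _ _ hi, mono_apply, h2 i hi]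
      rfl
  induction l with
  | nil => exact ⟨fun t => t.elim0, fun t => t.elim0, fun t => t.elim0, by simp⟩
  | cons w l ih =>
    obtain ⟨j, hj, h1, h2⟩ := ih
    by_cases hw : w = []
    · subst hw
      rw [strip_nil_cons]
      refine ⟨fun t => j t + 1, fun a b h => Nat.succ_lt_succ (hj h), by simpa using h1, ?_⟩
      rintro (_ | i) hi
      · rfl
      · exact h2 i fun t ht => hi t (congrArg (· + 1) ht)
    · rw [strip_cons_of_ne hw]
      refine ⟨Fin.cons 0 fun t => j t + 1, ?_, ?_, ?_⟩
      · intro a b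
        refine Fin.cases (Fin.cases (by simp) (by simp) b) (fun a => ?_) a
        refine Fin.cases (by simp) (fun b h => ?_) b
        simpa using hj (Fin.succ_lt_succ_iff.1 h)
      · intro t
        refine Fin.cases rfl (fun t => ?_) t
        simpa using h1 t
      · rintro (_ | i) hi
        · exact absurd rfl (hi 0)
        · exact h2 i fun t ht => hi t.succ (by simpa using ht)

open Classical in
/-- The coefficient of `mono l` in `M_I` is `1` if the non-empty words of `l` form the sentence `I`,
and `0` otherwise. -/
theorem M_mono (I : Sentence A) (l : List (List A)) :
    M I (mono l) = if strip l = I then 1 else 0 := by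
  obtain ⟨j, hj, hm⟩ := exists_xSentence_strip l
  unfold M
  split_ifs with h
  · subst h
    rw [Nat.cast_eq_one, Nat.card_eq_one_iff_unique]
    refine ⟨⟨?_⟩, ⟨⟨OrderEmbedding.ofStrictMono j hj, hm⟩⟩⟩
    rintro ⟨j₁, h₁⟩ ⟨j₂, h₂⟩
    have := (xSentence_inj j₁.strictMono j₂.strictMono (h₁.trans h₂.symm)).2
    exact Subtype.ext (DFunLike.coe_injective (List.ofFn_injective this))
  · rw [Nat.cast_eq_zero, Nat.card_eq_zero]
    left
    refine ⟨fun ⟨j', h'⟩ => h ?_⟩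
    exact (xSentence_inj hj j'.strictMono (hm.trans h'.symm)).1


theorem mono_inj {l l' : List (List A)} (hl : l.length = l'.length) (h : mono l = mono l') :
    l = l' := by
  refine List.ext_getElem hl fun i h1 h2 => ?_
  have := congrArg (fun m : monomials A => FreeMonoid.toList (m.1 i)) h
  simpa [mono_apply, h1, h2] using this

theorem mono_mul_mono (x : List (List A × List A)) :
    mono (x.map Prod.fst) * mono (x.map Prod.snd) = mono (x.map fun p => p.1 ++ p.2) := by
  refine Subtype.ext (funext fun i => ?_)
  rw [Submonoid.coe_mul, Pi.mul_apply, mono_apply, mono_apply, mono_apply,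
    ← FreeMonoid.ofList_append]
  by_cases hi : i < x.length
  · simp [hi]
  · simp [List.getElem?_eq_none (not_lt.1 hi)]

theorem exists_allSplits_of_mul_eq_mono {l : List (List A)} {m m' : monomials A}
    (h : m * m' = mono l) :
    ∃ x ∈ allSplits l, mono (x.map Prod.fst) = m ∧ mono (x.map Prod.snd) = m' := by
  have hi : ∀ i, FreeMonoid.toList (m.1 i) ++ FreeMonoid.toList (m'.1 i) = l.getD i [] := by
    intro i
    have := congrArg (fun m : monomials A => FreeMonoid.toList (m.1 i)) h
    simpa [mono_apply] using this
  have hn : ∀ i, l.length ≤ i →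
      FreeMonoid.toList (m.1 i) = [] ∧ FreeMonoid.toList (m'.1 i) = [] := by
    intro i h
    have := hi i
    rw [List.getD_eq_default _ _ h] at this
    simpa using this
  refine ⟨(List.range l.length).map fun i =>
    (FreeMonoid.toList (m.1 i), FreeMonoid.toList (m'.1 i)), ?_, ?_, ?_⟩
  · rw [mem_allSplits]
    refine List.ext_getElem (by simp) fun i h1 h2 => ?_
    simp [hi, h2]
  all_goals
    refine Subtype.ext (funext fun i => ?_)
    rw [mono_apply]
    by_cases h : i < l.length
    · simp [h]
    · rw [List.getD_eq_default _ _ (by simpa using h)]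
      have := hn i (not_lt.1 h)
      first | exact this.1.symm | exact this.2.symm

open Classical in
/-- The coefficient of `M_K` in `M_I M_S`, for `l` the list of words of `K`. -/
theorem times_mono (I S : Sentence A) (l : List (List A)) :
    (M I).times (M S) (mono l) = ∑ x ∈ allSplits l,
      if strip (x.map Prod.fst) = I ∧ strip (x.map Prod.snd) = S then 1 else 0 := by
  have himg : {p : monomials A × monomials A | p.1 * p.2 = mono l} =
      (fun x : List (List A × List A) => (mono (x.map Prod.fst), mono (x.map Prod.snd))) ''
        (allSplits l : Set (List (List A × List A))) := by
    ext ⟨m, m'⟩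
    constructor
    · intro h
      obtain ⟨x, hx, h1, h2⟩ := exists_allSplits_of_mul_eq_mono h
      exact ⟨x, hx, Prod.ext h1 h2⟩
    · rintro ⟨x, hx, h⟩
      obtain ⟨rfl, rfl⟩ := Prod.ext_iff.1 h
      exact (mono_mul_mono x).trans (congrArg mono (mem_allSplits.1 hx))
  unfold Series.times
  rw [himg, finsum_mem_image, finsum_mem_coe_finset]
  · refine Finset.sum_congr rfl fun x _ => ?_
    rw [M_mono, M_mono, ite_and, ite_mul, one_mul, zero_mul]
  · intro x hx y hy h
    have hx := congrArg List.length (mem_allSplits.1 hx)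
    have hy := congrArg List.length (mem_allSplits.1 hy)
    rw [List.length_map] at hx hy
    obtain ⟨h1, h2⟩ := Prod.ext_iff.1 h
    have h1 := mono_inj (by simp [hx, hy]) h1
    have h2 := mono_inj (by simp [hx, hy]) h2
    rw [← List.zip_unzip x, ← List.zip_unzip y, List.unzip_eq_map, List.unzip_eq_map, h1, h2]

/-! ### The Bernstein operators in the basis `H` -/

open Classical in
/-- `M_S^⊥ H_K` is the sum of `H` of the non-empty prefixes over all ways of cutting the words of
`K` in two such that the non-empty suffixes form `S`. -/
theorem rperp_M (S : Sentence A) (F : NSym A) :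
    rperp (M S) F = ∑ K ∈ F.coeff.support,
      ∑ x ∈ allSplits ((FreeMonoid.toList K).map Subtype.val),
        if strip (x.map Prod.snd) = S then F.coeff K • H (strip (x.map Prod.fst)) else 0 := by
  have h : ∀ I : Sentence A, pairing F ((M I).times (M S)) • H I = ∑ K ∈ F.coeff.support,
      ∑ x ∈ allSplits ((FreeMonoid.toList K).map Subtype.val),
        if strip (x.map Prod.fst) = I ∧ strip (x.map Prod.snd) = S then F.coeff K • H I else 0 := by
    intro I
    rw [pairing, Finsupp.sum, Finset.sum_smul]
    refine Finset.sum_congr rfl fun K _ => ?_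
    rw [xSentence_coe, times_mono, Finset.mul_sum, Finset.sum_smul]
    refine Finset.sum_congr rfl fun x _ => ?_
    split_ifs <;> simp
  have hs : ∀ (x : List (List A × List A)) (c : ℚ), (Function.support fun I : Sentence A =>
      if strip (x.map Prod.fst) = I ∧ strip (x.map Prod.snd) = S then c • H I else 0).Finite := by
    intro x c
    refine (Set.finite_singleton (strip (x.map Prod.fst))).subset fun I hI => ?_
    by_contra hne
    exact hI (if_neg fun h => hne h.1.symm)
  unfold rperp
  simp_rw [h]
  rw [finsum_sum_comm]
  · refine Finset.sum_congr rfl fun K _ => ?_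
    rw [finsum_sum_comm _ _ fun x _ => hs x _]
    refine Finset.sum_congr rfl fun x _ => ?_
    rw [finsum_eq_single _ (strip (x.map Prod.fst))]
    · simp
    · exact fun I hI => if_neg fun h => hI h.1.symm
  · intro K _
    refine (Set.Finite.biUnion (Finset.finite_toSet _) fun x _ => hs x (F.coeff K)).subset
      (Finset.support_sum _ _)

/-- The free associative algebra on the letters of `A`, with basis the words. -/
abbrev WordAlg (A : Type*) := MonoidAlgebra ℚ (FreeMonoid A)

/-- The basis element of `WordAlg A` given by a word. -/
noncomputable def ofWord (w : List A) : WordAlg A := MonoidAlgebra.single (FreeMonoid.ofList w) 1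

@[simp] theorem ofWord_nil : ofWord ([] : List A) = 1 := rfl

theorem ofWord_append (u v : List A) : ofWord (u ++ v) = ofWord u * ofWord v := by
  simp [ofWord, MonoidAlgebra.single_mul_single]

/-- The linear map `WordAlg A → NSym A` sending a word `w` to `H_w`. -/
noncomputable def hLin : WordAlg A →ₗ[ℚ] NSym A where
  toFun p := p.coeff.sum fun u c => c • hWord (FreeMonoid.toList u)
  map_add' p q := by
    rw [MonoidAlgebra.coeff_add, Finsupp.sum_add_index'] <;> simp [add_smul]
  map_smul' c p := by
    rw [MonoidAlgebra.coeff_smul, Finsupp.sum_smul_index', Finsupp.smul_sum] <;> simp [mul_smul]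

@[simp] theorem hLin_ofWord (w : List A) : hLin (ofWord w) = hWord w := by
  simp [hLin, ofWord]

/-- The signed sum `∑ (-1)^{ℓ(q)} w(qʳ)` over all sentences `q` with `w(q) = w`: the antipode of the
word `w` for the deconcatenation of words. -/
noncomputable def alt (w : List A) : WordAlg A :=
  ∑ q ∈ (finite_maxWord_eq w).toFinset, (-1 : ℚ) ^ q.length • ofWord (maxWord q.reverse)

/-- The product `alt w_k ⋯ alt w_1` for `S = (w_1, …, w_k)`. -/
noncomputable def altSentence : Sentence A → WordAlg A
  | [] => 1
  | w :: S => altSentence S * alt w.1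

theorem maxWord_append (I J : Sentence A) : maxWord (I ++ J) = maxWord I ++ maxWord J := by
  simp [maxWord]

@[simp] theorem maxWord_nil : maxWord ([] : Sentence A) = [] := rfl

@[simp] theorem maxWord_cons (w : NWord A) (I : Sentence A) : maxWord (w :: I) = w.1 ++ maxWord I :=
  rfl

@[simp] theorem maxWord_eq_nil {I : Sentence A} : maxWord I = [] ↔ I = [] := by
  cases I with
  | nil => simp
  | cons w I => simp [w.2]

/-- As words of a sentence are non-empty, a prefix of a sentence is determined by its maximal
word. -/
theorem append_inj_of_maxWord {I I' J J' : Sentence A} (h : I ++ J = I' ++ J')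
    (hw : maxWord I = maxWord I') : I = I' ∧ J = J' := by
  rcases List.append_eq_append_iff.1 h with ⟨K, rfl, rfl⟩ | ⟨K, rfl, rfl⟩
  all_goals
    rw [maxWord_append] at hw
    have : K = [] := by simpa using hw
    simp [this]

theorem refines_nil_right {Q : Sentence A} : Refines Q [] ↔ Q = [] := by
  constructor
  · rintro ⟨b, rfl, hb⟩
    simp at hb
    simp [hb]
  · rintro rfl
    exact ⟨[], rfl, rfl⟩

theorem refines_cons_right {Q S : Sentence A} {w : NWord A} :
    Refines Q (w :: S) ↔ ∃ Q₁ Q₂, Q₁ ++ Q₂ = Q ∧ maxWord Q₁ = w.1 ∧ Refines Q₂ S := by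
  constructor
  · rintro ⟨_ | ⟨q, b⟩, rfl, hb⟩
    · simp at hb
    · simp only [List.map_cons, List.cons.injEq] at hb
      exact ⟨q, b.flatten, rfl, hb.1, b, rfl, hb.2⟩
  · rintro ⟨q, _, rfl, h1, b, rfl, hb⟩
    exact ⟨q :: b, rfl, by simp [h1, hb]⟩

theorem finite_refinements (S : Sentence A) : {Q : Sentence A | Refines Q S}.Finite :=
  (finite_maxWord_eq (maxWord S)).subset fun _ h => (Refines.maxWord_eq h).symm

/-- A refinement of `S` consists of one sentence `q` with `w(q) = w_i` for each word `w_i` of `S`,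
so the signed sum over the refinements is a product. -/
theorem altSentence_eq_sum (S : Sentence A) :
    altSentence S = ∑ Q ∈ (finite_refinements S).toFinset,
      (-1 : ℚ) ^ Q.length • ofWord (maxWord Q.reverse) := by
  induction S with
  | nil =>
    have : (finite_refinements ([] : Sentence A)).toFinset = {[]} := by
      ext Q; simp [refines_nil_right]
    simp [altSentence, this]
  | cons w S ih =>
    rw [altSentence, ih, alt, Finset.sum_mul_sum, Finset.sum_comm, ← Finset.sum_product']
    refine Finset.sum_nbij (fun p => p.1 ++ p.2) ?_ ?_ ?_ ?_
    · rintro ⟨q, Q⟩ h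
      simp only [Finset.mem_product, Set.Finite.mem_toFinset, Set.mem_ofPred_eq] at h ⊢
      exact refines_cons_right.2 ⟨q, Q, rfl, h⟩
    · rintro ⟨q, Q⟩ h ⟨q', Q'⟩ h' e
      simp only [Finset.coe_product, Set.mem_prod, SetLike.mem_coe, Set.Finite.mem_toFinset,
        Set.mem_ofPred_eq] at h h'
      exact Prod.ext_iff.2 (append_inj_of_maxWord e (h.1.trans h'.1.symm))
    · intro Q hQ
      simp only [SetLike.mem_coe, Set.Finite.mem_toFinset, Set.mem_ofPred_eq] at hQ
      obtain ⟨q, Q, rfl, h⟩ := refines_cons_right.1 hQ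
      exact ⟨(q, Q), by simpa using h, rfl⟩
    · rintro ⟨q, Q⟩ -
      rw [smul_mul_smul_comm, List.reverse_append, maxWord_append, ofWord_append,
        List.length_append, pow_add, mul_comm]

theorem altSentence_concat (S : Sentence A) (w : NWord A) :
    altSentence (S ++ [w]) = alt w.1 * altSentence S := by
  induction S with
  | nil => simp [altSentence]
  | cons v S ih => rw [List.cons_append, altSentence, ih, altSentence, mul_assoc]

/-- The Bernstein operators in the basis `H`, extended linearly in the index `v`: on `H_K`, the sum
over all ways of cutting the words of `K` in two, where the prefixes are kept and the suffixes `b_1,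
…, b_k` contribute `alt b_k ⋯ alt b_1` (an empty suffix contributes `alt [] = 1`). -/
noncomputable def bernLin (p : WordAlg A) : NSym A →ₗ[ℚ] NSym A where
  toFun F := F.coeff.sum fun K c => c • ∑ x ∈ allSplits ((FreeMonoid.toList K).map Subtype.val),
    hLin (p * altSentence (strip (x.map Prod.snd))) * H (strip (x.map Prod.fst))
  map_add' F G := by
    rw [MonoidAlgebra.coeff_add, Finsupp.sum_add_index'] <;> simp [add_smul]
  map_smul' c F := by
    rw [MonoidAlgebra.coeff_smul, Finsupp.sum_smul_index', Finsupp.smul_sum] <;> simp [mul_smul]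

theorem bernLin_H (p : WordAlg A) (K : Sentence A) :
    bernLin p (H K) = ∑ x ∈ allSplits (K.map Subtype.val),
      hLin (p * altSentence (strip (x.map Prod.snd))) * H (strip (x.map Prod.fst)) := by
  simp [bernLin, H]

open Classical in
theorem bernstein_eq_bernLin (v : List A) (F : NSym A) :
    bernstein v F = bernLin (ofWord v) F := by
  have h : ∀ Q : Sentence A, (-1 : ℚ) ^ Q.length •
      (hWord (v ++ maxWord Q.reverse) * ∑ S ∈ coarsenings Q, rperp (M S) F) =
      ∑ K ∈ F.coeff.support, ∑ x ∈ allSplits ((FreeMonoid.toList K).map Subtype.val),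
        if Refines Q (strip (x.map Prod.snd)) then F.coeff K • (-1 : ℚ) ^ Q.length •
          (hWord (v ++ maxWord Q.reverse) * H (strip (x.map Prod.fst))) else 0 := by
    intro Q
    simp_rw [rperp_M]
    rw [Finset.sum_comm, Finset.mul_sum, Finset.smul_sum]
    refine Finset.sum_congr rfl fun K _ => ?_
    rw [Finset.sum_comm, Finset.mul_sum, Finset.smul_sum]
    refine Finset.sum_congr rfl fun x _ => ?_
    rw [Finset.sum_ite_eq]
    simp only [coarsenings, Set.Finite.mem_toFinset, Set.mem_ofPred_eq]
    split_ifs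
    · rw [mul_smul_comm, smul_comm]
    · simp
  have hs : ∀ (x : List (List A × List A)) (f : Sentence A → NSym A),
      (Function.support fun Q : Sentence A =>
        if Refines Q (strip (x.map Prod.snd)) then f Q else 0).Finite := by
    intro x f
    refine (finite_refinements (strip (x.map Prod.snd))).subset fun Q hQ => ?_
    by_contra hne
    exact hQ (if_neg hne)
  unfold bernstein
  simp_rw [h]
  rw [finsum_sum_comm]
  · refine Finset.sum_congr rfl fun K _ => ?_
    rw [finsum_sum_comm _ _ fun x _ => hs x _]
    refine Eq.trans ?_ Finset.smul_sum.symm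
    refine Finset.sum_congr rfl fun x _ => ?_
    rw [finsum_eq_sum_of_support_subset
        (s := (finite_refinements (strip (x.map Prod.snd))).toFinset),
      altSentence_eq_sum, Finset.mul_sum, map_sum, Finset.sum_mul, Finset.smul_sum]
    · refine Finset.sum_congr rfl fun Q hQ => ?_
      rw [Set.Finite.mem_toFinset, Set.mem_ofPred_eq] at hQ
      rw [if_pos hQ, mul_smul_comm, map_smul, ← ofWord_append, hLin_ofWord, smul_mul_assoc]
    · intro Q hQ
      rw [Set.Finite.coe_toFinset]
      by_contra hne
      exact hQ (if_neg hne)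
  · intro K _
    exact (Set.Finite.biUnion (Finset.finite_toSet _) fun x _ => hs x _).subset
      (Finset.support_sum _ _)


/-! ### The Pieri rule -/

/-- Coassociativity of the deconcatenation of words. -/
theorem sum_splits_assoc {N : Type*} [AddCommMonoid N] (w : List A)
    (f : List A → List A → List A → N) :
    ∑ x ∈ splits w, ∑ y ∈ splits x.1, f y.1 y.2 x.2 =
      ∑ x ∈ splits w, ∑ y ∈ splits x.2, f x.1 y.1 y.2 := by
  rw [Finset.sum_sigma', Finset.sum_sigma']
  refine Finset.sum_bij' (fun z _ => ⟨(z.2.1, z.2.2 ++ z.1.2), (z.2.2, z.1.2)⟩)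
    (fun z _ => ⟨(z.1.1 ++ z.2.1, z.2.2), (z.1.1, z.2.1)⟩) ?_ ?_ ?_ ?_ ?_
  all_goals
    rintro ⟨⟨a, b⟩, ⟨c, d⟩⟩ h
    simp only [Finset.mem_sigma, mem_splits] at h
    obtain ⟨h1, h2⟩ := h
    subst h2
    subst h1
    simp

theorem alt_nil : alt ([] : List A) = 1 := by
  have : (finite_maxWord_eq ([] : List A)).toFinset = {[]} := by
    ext Q; simp
  simp [alt]

/-- The antipode identity: the term with `x.2 = []` is `alt w`, and the other terms run over the
same sentences with opposite signs, the last word `x.2` being split off. -/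
theorem sum_splits_ofWord_mul_alt (w : List A) :
    ∑ x ∈ splits w, ofWord x.2 * alt x.1 = if w = [] then 1 else 0 := by
  split_ifs with hw
  · subst hw
    simp [alt_nil]
  · classical
    rw [← Finset.add_sum_erase _ _ (show (w, []) ∈ splits w by simp), ofWord_nil, one_mul,
      add_eq_zero_iff_eq_neg, alt, ← Finset.sum_neg_distrib]
    simp_rw [alt, Finset.mul_sum, ← Finset.sum_neg_distrib]
    rw [Finset.sum_sigma']
    symm
    have hne : ∀ x ∈ (splits w).erase (w, []), x.2 ≠ [] := by
      rintro ⟨a, b⟩ h rfl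
      simp at h
    refine Finset.sum_bij
      (fun z hz => z.2 ++ [⟨z.1.2, hne z.1 (Finset.mem_sigma.1 hz).1⟩]) ?_ ?_ ?_ ?_
    · rintro ⟨⟨a, b⟩, q⟩ h
      simp only [Finset.mem_sigma, Finset.mem_erase, mem_splits, Set.Finite.mem_toFinset,
        Set.mem_ofPred_eq] at h
      simp [maxWord_append, h]
    · rintro ⟨⟨a, b⟩, q⟩ h ⟨⟨a', b'⟩, q'⟩ h' e
      simp only [Finset.mem_sigma, Finset.mem_erase, mem_splits, Set.Finite.mem_toFinset,
        Set.mem_ofPred_eq] at h h'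
      obtain ⟨e₁, e₂⟩ := List.append_inj' e rfl
      simp only at e₁
      simp only [List.cons.injEq, Subtype.mk.injEq, and_true] at e₂
      subst e₁
      subst e₂
      obtain ⟨-, rfl⟩ := h
      obtain ⟨-, rfl⟩ := h'
      rfl
    · intro Q hQ
      simp only [Set.Finite.mem_toFinset, Set.mem_ofPred_eq] at hQ
      rcases List.eq_nil_or_concat Q with rfl | ⟨q, b, rfl⟩
      · exact absurd hQ.symm hw
      · refine ⟨⟨(maxWord q, b.1), q⟩, ?_, ?_⟩
        · rw [List.concat_eq_append, maxWord_append] at hQ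
          simpa [b.2] using hQ
        · simp
    · rintro ⟨⟨a, b⟩, q⟩ h
      simp [ofWord_append, pow_succ]

theorem hWord_nil : hWord ([] : List A) = 1 := by simp [hWord]

theorem hWord_of_ne {w : List A} (h : w ≠ []) : hWord w = H [⟨w, h⟩] := by simp [hWord, h]

theorem H_append (I J : Sentence A) : H (I ++ J) = H I * H J := by
  simp [H, MonoidAlgebra.single_mul_single]

theorem H_strip_append_singleton (l : List (List A)) (w : List A) :
    H (strip (l ++ [w])) = H (strip l) * hWord w := by
  rw [strip_append, H_append]
  by_cases h : w = []
  · subst h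
    rw [hWord_nil, strip_nil_cons]; rfl
  · rw [hWord_of_ne h, strip_cons_of_ne h]; rfl

theorem altSentence_strip_append_singleton (l : List (List A)) (w : List A) :
    altSentence (strip (l ++ [w])) = alt w * altSentence (strip l) := by
  rw [strip_append]
  by_cases h : w = []
  · subst h
    rw [alt_nil, strip_nil_cons, strip_nil, List.append_nil, one_mul]
  · rw [strip_cons_of_ne h, strip_nil, altSentence_concat]

theorem bernLin_sum {ι : Type*} (s : Finset ι) (p : ι → WordAlg A) (F : NSym A) :
    bernLin (∑ i ∈ s, p i) F = ∑ i ∈ s, bernLin (p i) F := by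
  simp only [bernLin, LinearMap.coe_mk, AddHom.coe_mk, Finsupp.sum]
  rw [Finset.sum_comm]
  refine Finset.sum_congr rfl fun K _ => ?_
  rw [← Finset.smul_sum, Finset.sum_comm]
  simp_rw [Finset.sum_mul, map_sum, Finset.sum_mul]

theorem bernLin_zero (F : NSym A) : bernLin 0 F = 0 := by
  simpa using bernLin_sum (∅ : Finset ℕ) (fun _ => 0) F

/-- The last word of `H_K H_w` can be cut independently of those of `K`, and its suffix contributes
the leftmost factor of the product of antipodes. -/
theorem bernLin_mul_hWord_right (p : WordAlg A) (F : NSym A) (w : List A) :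
    bernLin p (F * hWord w) = ∑ x ∈ splits w, bernLin (p * alt x.2) F * hWord x.1 := by
  by_cases hw : w = []
  · subst hw
    simp [alt_nil, hWord_nil]
  have key : ∀ K : Sentence A, bernLin p (H K * hWord w) =
      ∑ x ∈ splits w, bernLin (p * alt x.2) (H K) * hWord x.1 := by
    intro K
    rw [hWord_of_ne hw, ← H_append, bernLin_H, List.map_append, List.map_singleton,
      sum_allSplits_concat, Finset.sum_comm]
    refine Finset.sum_congr rfl fun y _ => ?_
    rw [bernLin_H, Finset.sum_mul]
    refine Finset.sum_congr rfl fun x _ => ?_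
    rw [List.map_append, List.map_append, List.map_singleton, List.map_singleton,
      H_strip_append_singleton, altSentence_strip_append_singleton, mul_assoc p, mul_assoc]
  refine MonoidAlgebra.induction_linear F ?_ ?_ ?_
  · simp
  · intro F G hF hG
    simp only [add_mul, map_add, hF, hG, Finset.sum_add_distrib]
  · intro K c
    have : (MonoidAlgebra.single K c : NSym A) = c • H (FreeMonoid.toList K) := by
      simp [H]
    rw [this, smul_mul_assoc, map_smul, key, Finset.smul_sum]
    simp only [map_smul, smul_mul_assoc]

/-- The inversion of `bernLin_mul_hWord_right` by the antipode identity. -/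
theorem bernLin_mul_hWord (p : WordAlg A) (F : NSym A) (w : List A) :
    bernLin p F * hWord w = ∑ x ∈ splits w, bernLin (p * ofWord x.2) (F * hWord x.1) := by
  simp_rw [bernLin_mul_hWord_right]
  rw [sum_splits_assoc w fun a b c => bernLin (p * ofWord c * alt b) F * hWord a]
  have : ∀ x : List A × List A, ∑ y ∈ splits x.2, bernLin (p * ofWord y.2 * alt y.1) F * hWord x.1 =
      if x.2 = [] then bernLin p F * hWord x.1 else 0 := by
    intro x
    simp_rw [mul_assoc p]
    rw [← Finset.sum_mul, ← bernLin_sum, ← Finset.mul_sum, sum_splits_ofWord_mul_alt]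
    split_ifs <;> simp [bernLin_zero]
  simp_rw [this]
  rw [Finset.sum_eq_single (w, [])]
  · simp
  · rintro ⟨a, b⟩ h hne
    refine if_neg fun (hb : b = []) => hne ?_
    subst hb
    simpa using h
  · simp

theorem bernstein_mul_hWord (v : List A) (F : NSym A) (w : List A) :
    bernstein v F * hWord w = ∑ x ∈ splits w, bernstein (v ++ x.2) (F * hWord x.1) := by
  simp_rw [bernstein_eq_bernLin, bernLin_mul_hWord, ofWord_append]

theorem bernstein_sum {ι : Type*} (v : List A) (s : Finset ι) (F : ι → NSym A) :
    bernstein v (∑ i ∈ s, F i) = ∑ i ∈ s, bernstein v (F i) := by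
  simp_rw [bernstein_eq_bernLin, map_sum]

theorem immaculate_singleton (w : NWord A) : immaculate [w] = H [w] := by
  have h1 : (1 : NSym A) = H [] := rfl
  rw [immaculate, List.foldr_cons, List.foldr_nil, bernstein_eq_bernLin, h1, bernLin_H]
  simp [altSentence, hWord_of_ne w.2, ← h1]

/-! ### Growing diagrams box by box -/

/-- Add a box of color `a` at the end of row `r` of `J`, or in a new last row if there is no
row `r`. -/
def push : Sentence A → ℕ → A → Sentence A
  | [], _, a => [⟨[a], by simp⟩]
  | v :: J, 0, a => ⟨v.1 ++ [a], by simp⟩ :: J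
  | v :: J, r + 1, a => v :: push J r a

/-- Add boxes to `J` one after the other; a box is given by its row and its color. -/
def build (J : Sentence A) (t : List (ℕ × A)) : Sentence A :=
  t.foldl (fun J x => push J x.1 x.2) J

/-- In the process of adding boxes to `J`, no row is skipped: each box goes to an existing row or to
the row just below the last one. -/
def Adm : Sentence A → List (ℕ × A) → Prop
  | _, [] => True
  | J, x :: t => x.1 ≤ J.length ∧ Adm (push J x.1 x.2) t

@[simp] theorem build_nil (J : Sentence A) : build J [] = J := rfl

@[simp] theorem build_cons (J : Sentence A) (x : ℕ × A) (t : List (ℕ × A)) :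
    build J (x :: t) = build (push J x.1 x.2) t := rfl

theorem build_append (J : Sentence A) (s t : List (ℕ × A)) :
    build J (s ++ t) = build (build J s) t := by
  simp [build]

theorem adm_append {J : Sentence A} {s t : List (ℕ × A)} :
    Adm J (s ++ t) ↔ Adm J s ∧ Adm (build J s) t := by
  induction s generalizing J with
  | nil => simp [Adm]
  | cons x s ih => simp [Adm, ih, and_assoc]

theorem build_map_succ (v : NWord A) (J : Sentence A) (t : List (ℕ × A)) :
    build (v :: J) (t.map fun x => (x.1 + 1, x.2)) = v :: build J t := by
  induction t generalizing J with
  | nil => rfl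
  | cons x t ih => simp [push, ih]

theorem adm_map_succ {v : NWord A} {J : Sentence A} {t : List (ℕ × A)} :
    Adm (v :: J) (t.map fun x => (x.1 + 1, x.2)) ↔ Adm J t := by
  induction t generalizing J with
  | nil => simp [Adm]
  | cons x t ih => simp [Adm, push, ih]

theorem build_map_zero (v : NWord A) (J : Sentence A) (w : List A) :
    build (v :: J) (w.map fun a => (0, a)) =
      ⟨v.1 ++ w, List.append_ne_nil_of_left_ne_nil v.2 _⟩ :: J := by
  induction w generalizing v with
  | nil => simp
  | cons a w ih => simp [push, ih]

theorem build_nil_map_zero {w : List A} (h : w ≠ []) :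
    build [] (w.map fun a => (0, a)) = [⟨w, h⟩] := by
  cases w with
  | nil => exact absurd rfl h
  | cons a w => simp [push, build_map_zero]

theorem adm_map_zero (J : Sentence A) (w : List A) : Adm J (w.map fun a => (0, a)) := by
  induction w generalizing J with
  | nil => simp [Adm]
  | cons a w ih => simp [Adm, ih]

/-- The relation between two consecutive boxes that do not form a descent: the second one is not
in a strictly lower row. -/
abbrev RowGE (x y : ℕ × A) : Prop := y.1 ≤ x.1

/-- A sequence without descents ends with its boxes in the first row. -/
theorem exists_eq_map_succ_append_map_zero {t : List (ℕ × A)} (h : t.Pairwise RowGE) :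
    ∃ (s : List (ℕ × A)) (b : List A),
      t = s.map (fun x => (x.1 + 1, x.2)) ++ b.map fun a => (0, a) := by
  induction t with
  | nil => exact ⟨[], [], rfl⟩
  | cons x t ih =>
    obtain ⟨s, b, rfl⟩ := ih h.of_cons
    rcases x with ⟨_ | r, a⟩
    · have : s = [] := by
        cases s with
        | nil => rfl
        | cons y s =>
          have := (List.pairwise_cons.1 h).1 (y.1 + 1, y.2) (by simp)
          simp [RowGE] at this
      subst this
      exact ⟨[], a :: b, by simp⟩
    · exact ⟨(r, a) :: s, b, by simp⟩

theorem map_succ_append_map_zero_inj {s s' : List (ℕ × A)} {b b' : List A}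
    (h : s.map (fun x => (x.1 + 1, x.2)) ++ b.map (fun a => (0, a)) =
      s'.map (fun x => (x.1 + 1, x.2)) ++ b'.map fun a => (0, a)) : s = s' ∧ b = b' := by
  induction s generalizing s' with
  | nil =>
    cases s' with
    | nil =>
      refine ⟨rfl, ?_⟩
      simpa [Function.comp_def] using congrArg (List.map Prod.snd) h
    | cons y s' => cases b <;> simp at h
  | cons x s ih =>
    cases s' with
    | nil => cases b' <;> simp at h
    | cons y s' =>
      simp only [List.map_cons, List.cons_append, List.cons.injEq, Prod.mk.injEq,
        Nat.add_right_cancel_iff] at h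
      obtain ⟨rfl, rfl⟩ := ih h.2
      exact ⟨by rw [Prod.ext h.1.1 h.1.2], rfl⟩

/-- The ways of adding boxes to `J` whose colors spell `w`, without skipping a row and without
descents. -/
def stripSet (J : Sentence A) (w : List A) : Set (List (ℕ × A)) :=
  {t | t.map Prod.snd = w ∧ t.Pairwise RowGE ∧ Adm J t}

theorem stripSet_nil (w : List A) : stripSet [] w = {w.map fun a => (0, a)} := by
  ext t
  simp only [stripSet, Set.mem_ofPred_eq, Set.mem_singleton_iff]
  constructor
  · rintro ⟨rfl, ht, hA⟩
    obtain ⟨s, b, rfl⟩ := exists_eq_map_succ_append_map_zero ht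
    cases s with
    | nil => simp [Function.comp_def]
    | cons x s => simp [Adm] at hA
  · rintro rfl
    exact ⟨by simp [Function.comp_def], by simp [List.pairwise_map, List.pairwise_of_forall],
      adm_map_zero _ _⟩

/-- A strip added to `v :: J` is a strip added to `J` followed by an extension of the first row. -/
theorem mem_stripSet_cons {v : NWord A} {J : Sentence A} {w : List A} {t : List (ℕ × A)} :
    t ∈ stripSet (v :: J) w ↔ ∃ x ∈ splits w, ∃ s ∈ stripSet J x.1,
      s.map (fun x => (x.1 + 1, x.2)) ++ x.2.map (fun a => (0, a)) = t := by
  constructor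
  · rintro ⟨rfl, ht, hA⟩
    obtain ⟨s, b, rfl⟩ := exists_eq_map_succ_append_map_zero ht
    refine ⟨(s.map Prod.snd, b), by simp [Function.comp_def], s, ⟨rfl, ?_, ?_⟩, rfl⟩
    · have := (List.pairwise_append.1 ht).1
      rw [List.pairwise_map] at this
      exact this.imp fun h => Nat.le_of_succ_le_succ h
    · exact adm_map_succ.1 (adm_append.1 hA).1
  · rintro ⟨⟨a, b⟩, hx, s, ⟨h1, h2, h3⟩, rfl⟩
    simp only at h1
    refine ⟨by simpa [Function.comp_def, h1] using hx, ?_, ?_⟩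
    · rw [List.pairwise_append, List.pairwise_map, List.pairwise_map]
      exact ⟨h2.imp fun h => Nat.succ_le_succ h, by simp [List.pairwise_of_forall], by simp⟩
    · exact adm_append.2 ⟨adm_map_succ.2 h3, by rw [build_map_succ]; exact adm_map_zero _ _⟩

theorem finite_adm (J : Sentence A) (w : List A) :
    {t : List (ℕ × A) | t.map Prod.snd = w ∧ Adm J t}.Finite := by
  induction w generalizing J with
  | nil => exact (Set.finite_singleton []).subset fun t ht => by simpa using ht.1
  | cons a w ih =>
    refine (Set.Finite.biUnion (Set.finite_le_nat J.length) fun r _ =>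
      (ih (push J r a)).image (List.cons (r, a))).subset ?_
    rintro (_ | ⟨⟨r, b⟩, t⟩) ⟨h1, h2⟩
    · simp at h1
    · simp only [List.map_cons, List.cons.injEq] at h1
      obtain ⟨rfl, h1⟩ := h1
      exact Set.mem_biUnion h2.1 ⟨t, ⟨h1, h2.2⟩, rfl⟩

theorem finite_stripSet (J : Sentence A) (w : List A) : (stripSet J w).Finite :=
  (finite_adm J w).subset fun _ h => ⟨h.1, h.2.2⟩

/-- The right Pieri rule for the colored immaculate functions: in `𝔹_{v b}(𝔖_J H_a)`, with `w = ab`,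
the suffix `b` prolongs the first row, and `a` is added to the rows below before it. -/
theorem immaculate_mul_hWord (J : Sentence A) (w : List A) :
    immaculate J * hWord w = ∑ t ∈ (finite_stripSet J w).toFinset, immaculate (build J t) := by
  induction J generalizing w with
  | nil =>
    have : (finite_stripSet [] w).toFinset = {w.map fun a => (0, a)} := by
      ext t; simp [stripSet_nil]
    rw [this, Finset.sum_singleton]
    by_cases hw : w = []
    · subst hw
      simp [hWord_nil]
    · rw [build_nil_map_zero hw, immaculate_singleton, hWord_of_ne hw]
      exact one_mul _
  | cons v J ih =>
    have hc : ∀ (v : NWord A) (J : Sentence A),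
        immaculate (v :: J) = bernstein v.1 (immaculate J) :=
      fun _ _ => rfl
    rw [hc, bernstein_mul_hWord]
    simp_rw [ih, bernstein_sum]
    rw [Finset.sum_sigma']
    refine Finset.sum_nbij
      (fun z => z.2.map (fun x => (x.1 + 1, x.2)) ++ z.1.2.map (fun a => (0, a))) ?_ ?_ ?_ ?_
    · rintro ⟨x, s⟩ h
      rw [Finset.mem_sigma, Set.Finite.mem_toFinset] at h
      rw [Set.Finite.mem_toFinset]
      exact mem_stripSet_cons.2 ⟨x, h.1, s, h.2, rfl⟩
    · rintro ⟨⟨a, b⟩, s⟩ h ⟨⟨a', b'⟩, s'⟩ h' e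
      simp only [Finset.coe_sigma, Set.mem_sigma_iff, SetLike.mem_coe,
        Set.Finite.mem_toFinset] at h h'
      obtain ⟨rfl, rfl⟩ := map_succ_append_map_zero_inj e
      obtain rfl : s.map Prod.snd = a := h.2.1
      obtain rfl : s.map Prod.snd = a' := h'.2.1
      rfl
    · intro t ht
      rw [Set.Finite.coe_toFinset] at ht
      obtain ⟨x, hx, s, hs, rfl⟩ := mem_stripSet_cons.1 ht
      exact ⟨⟨x, s⟩, by simpa using ⟨by simpa using hx, hs⟩, rfl⟩
    · rintro ⟨⟨a, b⟩, s⟩ -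
      rw [build_append, build_map_succ, build_map_zero, hc]


/-! ### A recursion for the colored ribbon functions -/

/-- The concatenation of two non-empty words. -/
def cat (v w : NWord A) : NWord A := ⟨v.1 ++ w.1, List.append_ne_nil_of_left_ne_nil v.2 _⟩

theorem cat_ne_right (v w : NWord A) : cat v w ≠ w := fun h => v.2 (by
  simpa [cat, Subtype.ext_iff] using h)

theorem refines_append_singleton {Q D : Sentence A} {d : NWord A} :
    Refines Q (D ++ [d]) ↔ ∃ Q₁ Q₂, Q₁ ++ Q₂ = Q ∧ Refines Q₁ D ∧ maxWord Q₂ = d.1 := by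
  constructor
  · rintro ⟨b, rfl, hb⟩
    rw [List.map_append, List.map_eq_append_iff] at hb
    obtain ⟨b₁, b₂, rfl, h1, h2⟩ := hb
    obtain ⟨q, rfl, hq⟩ := List.map_eq_singleton_iff.1 (h2.trans (List.map_singleton ..))
    exact ⟨b₁.flatten, q, by simp, ⟨b₁, rfl, h1⟩, hq⟩
  · rintro ⟨_, q, rfl, ⟨b, rfl, hb⟩, hq⟩
    exact ⟨b ++ [q], by simp, by simp [hb, hq]⟩

theorem refines_concat_concat {C D : Sentence A} {c d : NWord A} :
    Refines (C ++ [c]) (D ++ [d]) ↔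
      ∃ Q₁ Q₂, Q₁ ++ Q₂ = C ∧ Refines Q₁ D ∧ maxWord Q₂ ++ c.1 = d.1 := by
  rw [refines_append_singleton]
  constructor
  · rintro ⟨Q₁, Q₂, h, hD, hd⟩
    rcases List.eq_nil_or_concat Q₂ with rfl | ⟨Q₂, c', rfl⟩
    · exact absurd hd.symm d.2
    · rw [List.concat_eq_append, ← List.append_assoc] at h
      obtain ⟨rfl, h⟩ := List.append_inj' h rfl
      obtain rfl : c' = c := by simpa using h
      exact ⟨Q₁, Q₂, rfl, hD, by simpa [maxWord_append] using hd⟩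
  · rintro ⟨Q₁, Q₂, rfl, hD, hd⟩
    exact ⟨Q₁, Q₂ ++ [c], by simp, hD, by simpa [maxWord_append] using hd⟩

theorem ne_nil_of_refines_concat {C D : Sentence A} {c : NWord A} (h : Refines (C ++ [c]) D) :
    D ≠ [] := by
  rintro rfl
  simpa using refines_nil_right.1 h

/-- A coarsening of `(…, cw)` arises from one of `(…, c)` by lengthening its last word by `w`. -/
theorem refines_concat_cat {C D : Sentence A} {c w e : NWord A} :
    Refines (C ++ [cat c w]) (D ++ [e]) ↔ ∃ d, e = cat d w ∧ Refines (C ++ [c]) (D ++ [d]) := by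
  simp_rw [refines_concat_concat]
  constructor
  · rintro ⟨Q₁, Q₂, h, hD, he⟩
    exact ⟨⟨maxWord Q₂ ++ c.1, by simp [c.2]⟩, Subtype.ext (by simp [cat, ← he]), Q₁, Q₂, h, hD,
      rfl⟩
  · rintro ⟨d, rfl, Q₁, Q₂, h, hD, he⟩
    exact ⟨Q₁, Q₂, h, hD, by simp [cat, ← he]⟩

/-- In a coarsening of `(…, c, w)` the last word `w` is either kept apart or concatenated to a
coarsening of `(…, c)`. -/
theorem refines_concat_concat_concat {C D : Sentence A} {c w e : NWord A} :
    Refines (C ++ [c] ++ [w]) (D ++ [e]) ↔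
      (Refines (C ++ [c]) D ∧ e = w) ∨ ∃ d, e = cat d w ∧ Refines (C ++ [c]) (D ++ [d]) := by
  rw [refines_concat_concat]
  simp_rw [refines_append_singleton (D := D)]
  constructor
  · rintro ⟨Q₁, Q₂, h, hD, he⟩
    by_cases hQ : Q₂ = []
    · subst hQ
      rw [List.append_nil] at h
      subst h
      exact Or.inl ⟨hD, Subtype.ext (by simpa using he.symm)⟩
    · exact Or.inr ⟨⟨maxWord Q₂, by simpa using hQ⟩, Subtype.ext he.symm, Q₁, Q₂, h, hD, rfl⟩
  · rintro (⟨hD, rfl⟩ | ⟨d, rfl, Q₁, Q₂, h, hD, he⟩)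
    · exact ⟨C ++ [c], [], by simp, hD, by simp⟩
    · exact ⟨Q₁, Q₂, h, hD, by simp [cat, he]⟩

@[simp] theorem mem_coarsenings {Q S : Sentence A} : S ∈ coarsenings Q ↔ Refines Q S := by
  simp [coarsenings]

theorem exists_concat {D : Sentence A} (h : D ≠ []) : ∃ D' d, D = D' ++ [d] := by
  rcases List.eq_nil_or_concat D with rfl | ⟨D', d, rfl⟩
  · exact absurd rfl h
  · exact ⟨D', d, by simp⟩

open Classical in
theorem coarsenings_concat_concat (C : Sentence A) (c w : NWord A) :
    coarsenings (C ++ [c] ++ [w]) = (coarsenings (C ++ [c])).image (fun D => D ++ [w]) ∪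
      coarsenings (C ++ [cat c w]) := by
  ext E
  rw [Finset.mem_union, mem_coarsenings, mem_coarsenings, Finset.mem_image]
  constructor
  · intro h
    obtain ⟨D, e, rfl⟩ := exists_concat (ne_nil_of_refines_concat h)
    rcases refines_concat_concat_concat.1 h with ⟨hD, rfl⟩ | hd
    · exact Or.inl ⟨D, mem_coarsenings.2 hD, rfl⟩
    · exact Or.inr (refines_concat_cat.2 hd)
  · rintro (⟨D, h, rfl⟩ | h)
    · exact refines_concat_concat_concat.2 (Or.inl ⟨mem_coarsenings.1 h, rfl⟩)
    · obtain ⟨D, e, rfl⟩ := exists_concat (ne_nil_of_refines_concat h)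
      exact refines_concat_concat_concat.2 (Or.inr (refines_concat_cat.1 h))

theorem R_nil : R ([] : Sentence A) = 1 := by
  have : coarsenings ([] : Sentence A) = {[]} := by
    ext D
    rw [mem_coarsenings, Finset.mem_singleton]
    constructor
    · intro h
      simpa using Refines.maxWord_eq h
    · rintro rfl
      exact refines_nil_right.2 rfl
  simp [R, this]
  rfl

theorem R_singleton (w : NWord A) : R [w] = H [w] := by
  have : coarsenings [w] = {[w]} := by
    ext D
    rw [mem_coarsenings, Finset.mem_singleton, ← List.nil_append [w]]
    constructor
    · intro h
      obtain ⟨D, d, rfl⟩ := exists_concat (ne_nil_of_refines_concat h)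
      obtain ⟨Q₁, Q₂, h, hD, hd⟩ := refines_concat_concat.1 h
      obtain ⟨rfl, rfl⟩ := List.append_eq_nil_iff.1 h
      have hD : D = [] := by simpa using Refines.maxWord_eq hD
      rw [hD, Subtype.ext (hd.symm : d.1 = w.1)]
    · rintro rfl
      exact refines_concat_concat.2 ⟨[], [], rfl, refines_nil_right.2 rfl, by simp⟩
  simp [R, this]

/-- The product of a ribbon function and a generator: the coarsenings of `(…, c, w)` that keep `w`
apart give the left-hand side, the others are the coarsenings of `(…, cw)` and occur with the
opposite sign. -/
theorem R_concat_mul_H (C : Sentence A) (c w : NWord A) :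
    R (C ++ [c]) * H [w] = R (C ++ [c] ++ [w]) + R (C ++ [cat c w]) := by
  classical
  have hd : Disjoint ((coarsenings (C ++ [c])).image fun D => D ++ [w])
      (coarsenings (C ++ [cat c w])) := by
    rw [Finset.disjoint_left]
    intro E h1 h2
    obtain ⟨D, -, rfl⟩ := Finset.mem_image.1 h1
    obtain ⟨d, h, -⟩ := refines_concat_cat.1 (mem_coarsenings.1 h2)
    exact cat_ne_right d w h.symm
  have hs : ∀ D : Sentence A, (-1 : ℚ) ^ ((D.length : ℤ) - ((C ++ [c] ++ [w]).length : ℤ)) =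
      -(-1 : ℚ) ^ ((D.length : ℤ) - ((C ++ [cat c w]).length : ℤ)) := by
    intro D
    rw [List.length_append, List.length_append, List.length_append, List.length_singleton,
      List.length_singleton, List.length_singleton, Nat.cast_add, Nat.cast_one, ← sub_sub,
      zpow_sub_one₀ (by norm_num), inv_neg_one, mul_neg_one]
  have h2 : ∑ D ∈ coarsenings (C ++ [cat c w]),
      (-1 : ℚ) ^ ((D.length : ℤ) - ((C ++ [c] ++ [w]).length : ℤ)) • H D = -R (C ++ [cat c w]) := by
    rw [R, ← Finset.sum_neg_distrib]
    exact Finset.sum_congr rfl fun D _ => by rw [hs, neg_smul]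
  rw [R, R, coarsenings_concat_concat, Finset.sum_union hd, Finset.sum_image, h2,
    neg_add_cancel_right, Finset.sum_mul]
  · refine Finset.sum_congr rfl fun D _ => ?_
    rw [H_append, smul_mul_assoc, List.length_append (as := D),
      List.length_append (as := C ++ [c]), Nat.cast_add, Nat.cast_add, add_sub_add_right_eq_sub]
  · intro D _ D' _ h
    exact List.append_cancel_right h

/-! ### Descents of growth sequences -/

/-- The colors of the boxes of a growth sequence, cut after each descent. -/
def descWords (s : List (ℕ × A)) : List (List A) :=
  (s.splitBy fun x y => decide (y.1 ≤ x.1)).map (List.map Prod.snd)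

/-- `B` is the list of maximal descent-free runs of its concatenation. -/
structure IsRuns (B : List (List (ℕ × A))) : Prop where
  nil_notMem : [] ∉ B
  pairwise : ∀ g ∈ B, g.Pairwise RowGE
  isChain : B.IsChain fun g h => ∃ hg hh, (g.getLast hg).1 < (h.head hh).1

theorem splitBy_eq_iff_isRuns {s : List (ℕ × A)} {B : List (List (ℕ × A))} :
    s.splitBy (fun x y => decide (y.1 ≤ x.1)) = B ↔ s = B.flatten ∧ IsRuns B := by
  have ht : ∀ g : List (ℕ × A), g.IsChain RowGE ↔ g.Pairwise RowGE := fun g =>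
    haveI : IsTrans (ℕ × A) RowGE := ⟨fun _ _ _ h h' => le_trans h' h⟩
    List.isChain_iff_pairwise
  rw [List.splitBy_eq_iff]
  simp only [decide_eq_true_eq, decide_eq_false_iff_not, not_le]
  refine and_congr_right fun _ => ?_
  constructor
  · rintro ⟨h1, h2, h3⟩
    exact ⟨h1, fun g hg => (ht g).1 (h2 g hg), h3⟩
  · rintro ⟨h1, h2, h3⟩
    exact ⟨h1, fun g hg => (ht g).2 (h2 g hg), h3⟩

theorem descWords_eq_iff {s : List (ℕ × A)} {m : List (List A)} :
    descWords s = m ↔ ∃ B, s = B.flatten ∧ IsRuns B ∧ B.map (List.map Prod.snd) = m := by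
  constructor
  · intro h
    have := splitBy_eq_iff_isRuns.1 (Eq.refl (s.splitBy fun x y => decide (y.1 ≤ x.1)))
    exact ⟨_, this.1, this.2, h⟩
  · rintro ⟨B, h1, h2, rfl⟩
    rw [descWords, splitBy_eq_iff_isRuns.2 ⟨h1, h2⟩]

theorem isRuns_concat_append {B : List (List (ℕ × A))} {g t : List (ℕ × A)} (hg : g ≠ []) :
    IsRuns (B ++ [g ++ t]) ↔ IsRuns (B ++ [g]) ∧ (g ++ t).Pairwise RowGE := by
  constructor
  · rintro ⟨h1, h2, h3⟩
    refine ⟨⟨?_, ?_, ?_⟩, h2 _ (by simp)⟩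
    · simp only [List.mem_append, List.mem_singleton, not_or] at h1 ⊢
      exact ⟨h1.1, Ne.symm hg⟩
    · intro k hk
      rcases List.mem_append.1 hk with hk | hk
      · exact h2 k (by simp [hk])
      · rw [List.mem_singleton.1 hk]
        exact (List.pairwise_append.1 (h2 (g ++ t) (by simp))).1
    · rw [List.isChain_append] at h3 ⊢
      refine ⟨h3.1, by simp, fun x hx y hy => ?_⟩
      obtain rfl : g = y := by simpa using hy
      obtain ⟨ha, hb, h⟩ := h3.2.2 x hx _ rfl
      exact ⟨ha, hg, by rwa [List.head_append_of_ne_nil hg] at h⟩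
  · rintro ⟨⟨h1, h2, h3⟩, h4⟩
    refine ⟨?_, ?_, ?_⟩
    · simp only [List.mem_append, List.mem_singleton, not_or] at h1 ⊢
      exact ⟨h1.1, by simp [hg]⟩
    · intro k hk
      rcases List.mem_append.1 hk with hk | hk
      · exact h2 k (by simp [hk])
      · rwa [List.mem_singleton.1 hk]
    · rw [List.isChain_append] at h3 ⊢
      refine ⟨h3.1, by simp, fun x hx y hy => ?_⟩
      obtain rfl : g ++ t = y := by simpa using hy
      obtain ⟨ha, hb, h⟩ := h3.2.2 x hx _ rfl
      exact ⟨ha, by simp [hg], by rwa [List.head_append_of_ne_nil hg]⟩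

theorem isRuns_concat_concat {B : List (List (ℕ × A))} {g t : List (ℕ × A)} :
    IsRuns (B ++ [g] ++ [t]) ↔
      IsRuns (B ++ [g]) ∧ t.Pairwise RowGE ∧ ∃ hg ht, (g.getLast hg).1 < (t.head ht).1 := by
  constructor
  · rintro ⟨h1, h2, h3⟩
    rw [List.isChain_append] at h3
    exact ⟨⟨fun h => h1 (List.mem_append_left _ h),
      fun k hk => h2 k (List.mem_append_left _ hk), h3.1⟩,
      h2 t (by simp), h3.2.2 g (by simp) t rfl⟩
  · rintro ⟨⟨h1, h2, h3⟩, h4, hg, ht, h⟩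
    refine ⟨?_, ?_, ?_⟩
    · rw [List.mem_append, not_or]
      exact ⟨h1, by simpa using Ne.symm ht⟩
    · intro k hk
      rcases List.mem_append.1 hk with hk | hk
      · exact h2 k hk
      · rwa [List.mem_singleton.1 hk]
    · rw [List.isChain_append]
      refine ⟨h3, by simp, fun x hx y hy => ?_⟩
      obtain rfl : g = x := by simpa using hx
      obtain rfl : t = y := by simpa using hy
      exact ⟨hg, ht, h⟩

theorem pairwise_append_iff_of_last {g t : List (ℕ × A)} (hg : g.Pairwise RowGE)
    (ht : t.Pairwise RowGE) (hg' : g ≠ []) (ht' : t ≠ []) :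
    (g ++ t).Pairwise RowGE ↔ (t.head ht').1 ≤ (g.getLast hg').1 := by
  rw [List.pairwise_append]
  constructor
  · rintro ⟨-, -, h⟩
    exact h _ (List.getLast_mem hg') _ (List.head_mem ht')
  · refine fun h => ⟨hg, ht, fun x hx y hy => ?_⟩
    have h1 : (g.getLast hg').1 ≤ x.1 := hg.rel_getLast_of_rel_getLast_getLast hx le_rfl
    have h2 : y.1 ≤ (t.head ht').1 := ht.rel_head_of_rel_head_head hy le_rfl
    exact h2.trans (h.trans h1)

/-- The growth sequences, starting from the empty diagram, with descent composition `C`. They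
encode the standard colored immaculate tableaux with this descent composition. -/
def growthSet (C : Sentence A) : Set (List (ℕ × A)) :=
  {s | Adm [] s ∧ descWords s = C.map Subtype.val}

theorem map_snd_of_mem_growthSet {C : Sentence A} {s : List (ℕ × A)} (h : s ∈ growthSet C) :
    s.map Prod.snd = maxWord C := by
  obtain ⟨B, rfl, -, h⟩ := descWords_eq_iff.1 h.2
  rw [List.map_flatten, h]
  rfl

theorem finite_growthSet (C : Sentence A) : (growthSet C).Finite :=
  (finite_adm [] (maxWord C)).subset fun _ h => ⟨map_snd_of_mem_growthSet h, h.1⟩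

/-- A growth sequence whose descent composition is `(…, c, w)` or `(…, cw)` is a growth sequence
with descent composition `(…, c)` followed by a strip that spells `w`. -/
theorem growthSet_concat (C : Sentence A) (c w : NWord A) (s : List (ℕ × A)) :
    s ∈ growthSet (C ++ [c] ++ [w]) ∪ growthSet (C ++ [cat c w]) ↔
      ∃ s₁ ∈ growthSet (C ++ [c]), ∃ t ∈ stripSet (build [] s₁) w.1, s₁ ++ t = s := by
  constructor
  · rintro (⟨hA, h⟩ | ⟨hA, h⟩)
    · obtain ⟨B, rfl, hB, h⟩ := descWords_eq_iff.1 h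
      rw [List.map_append, List.map_eq_append_iff] at h
      obtain ⟨B₁, B₂, rfl, h1, h2⟩ := h
      obtain ⟨t, rfl, ht⟩ := List.map_eq_singleton_iff.1 (h2.trans (List.map_singleton ..))
      have h1' := h1
      rw [List.map_append, List.map_eq_append_iff] at h1'
      obtain ⟨B, B₂, rfl, -, h2⟩ := h1'
      obtain ⟨g, rfl, -⟩ := List.map_eq_singleton_iff.1 (h2.trans (List.map_singleton ..))
      rw [List.flatten_append] at hA ⊢
      rw [List.flatten_singleton] at hA ⊢
      obtain ⟨hA1, hA2⟩ := adm_append.1 hA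
      obtain ⟨hr, hp, -⟩ := isRuns_concat_concat.1 hB
      exact ⟨_, ⟨hA1, descWords_eq_iff.2 ⟨_, rfl, hr, h1⟩⟩, t, ⟨ht, hp, hA2⟩, rfl⟩
    · obtain ⟨B, rfl, hB, h⟩ := descWords_eq_iff.1 h
      rw [List.map_append, List.map_eq_append_iff] at h
      obtain ⟨B, B₂, rfl, h1, h2⟩ := h
      obtain ⟨k, rfl, hk⟩ := List.map_eq_singleton_iff.1 (h2.trans (List.map_singleton ..))
      obtain ⟨g, t, rfl, hg, ht⟩ := List.map_eq_append_iff.1 (hk : _ = c.1 ++ w.1)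
      have hg' : g ≠ [] := by rintro rfl; exact c.2 hg.symm
      obtain ⟨hr, hp⟩ := (isRuns_concat_append hg').1 hB
      have hf : (B ++ [g ++ t]).flatten = (B ++ [g]).flatten ++ t := by simp
      rw [hf] at hA ⊢
      obtain ⟨hA1, hA2⟩ := adm_append.1 hA
      exact ⟨_, ⟨hA1, descWords_eq_iff.2 ⟨_, rfl, hr, by simp [h1, hg]⟩⟩, t,
        ⟨ht, (List.pairwise_append.1 hp).2.1, hA2⟩, rfl⟩
  · rintro ⟨s, ⟨hA1, hs⟩, t, ⟨ht, hp, hA2⟩, rfl⟩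
    obtain ⟨B, rfl, hB, h⟩ := descWords_eq_iff.1 hs
    rw [List.map_append, List.map_eq_append_iff] at h
    obtain ⟨B, B₂, rfl, h1, h2⟩ := h
    obtain ⟨g, rfl, hg⟩ := List.map_eq_singleton_iff.1 (h2.trans (List.map_singleton ..))
    have hg' : g ≠ [] := by rintro rfl; exact c.2 hg.symm
    have ht' : t ≠ [] := by rintro rfl; exact w.2 ht.symm
    -- whether the strip starts with a descent decides between the two descent compositions
    by_cases hlt : (g.getLast hg').1 < (t.head ht').1
    · refine Or.inl ⟨adm_append.2 ⟨hA1, hA2⟩,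
        descWords_eq_iff.2 ⟨B ++ [g] ++ [t], by simp, ?_, ?_⟩⟩
      · exact isRuns_concat_concat.2 ⟨hB, hp, hg', ht', hlt⟩
      · simp [h1, hg, ht]
    · refine Or.inr ⟨adm_append.2 ⟨hA1, hA2⟩,
        descWords_eq_iff.2 ⟨B ++ [g ++ t], by simp, ?_, ?_⟩⟩
      · refine (isRuns_concat_append hg').2 ⟨hB, ?_⟩
        exact (pairwise_append_iff_of_last (hB.pairwise g (by simp)) hp hg' ht').2 (not_lt.1 hlt)
      · simp [h1, hg, ht, cat]

theorem growthSet_nil : growthSet ([] : Sentence A) = {[]} := by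
  ext s
  simp only [growthSet, descWords, List.map_nil, List.map_eq_nil_iff, List.splitBy_eq_nil,
    Set.mem_ofPred_eq, Set.mem_singleton_iff]
  exact ⟨fun h => h.2, by rintro rfl; exact ⟨trivial, rfl⟩⟩

theorem growthSet_singleton (w : NWord A) : growthSet [w] = stripSet [] w.1 := by
  ext s
  constructor
  · rintro ⟨hA, h⟩
    obtain ⟨B, rfl, hB, h⟩ := descWords_eq_iff.1 h
    obtain ⟨t, rfl, ht⟩ := List.map_eq_singleton_iff.1 (h.trans (List.map_singleton ..))
    rw [List.flatten_singleton] at hA ⊢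
    exact ⟨ht, hB.pairwise t (by simp), hA⟩
  · rintro ⟨h1, h2, h3⟩
    refine ⟨h3, descWords_eq_iff.2 ⟨[s], by simp, ⟨?_, by simpa using h2, by simp⟩, by simp [h1]⟩⟩
    rw [List.mem_singleton]
    rintro rfl
    exact w.2 h1.symm

theorem disjoint_growthSet (C : Sentence A) (c w : NWord A) :
    Disjoint (growthSet (C ++ [c] ++ [w])) (growthSet (C ++ [cat c w])) := by
  rw [Set.disjoint_left]
  intro s h1 h2
  have := congrArg List.length (h1.2.symm.trans h2.2)
  simp at this

/-- The sums of the immaculate functions over growth sequences satisfy the recursion of the ribbon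
functions: a strip added after the last box either starts with a descent or prolongs the last
run. -/
theorem sum_growthSet_mul_H (C : Sentence A) (c w : NWord A) :
    (∑ s ∈ (finite_growthSet (C ++ [c])).toFinset, immaculate (build [] s)) * H [w] =
      ∑ s ∈ (finite_growthSet (C ++ [c] ++ [w])).toFinset, immaculate (build [] s) +
        ∑ s ∈ (finite_growthSet (C ++ [cat c w])).toFinset, immaculate (build [] s) := by
  classical
  have hw : (H [w] : NSym A) = hWord w.1 := (hWord_of_ne w.2).symm
  rw [← Finset.sum_union (by
    simpa [← Finset.disjoint_coe] using disjoint_growthSet C c w), hw, Finset.sum_mul]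
  simp_rw [immaculate_mul_hWord]
  rw [Finset.sum_sigma']
  refine Finset.sum_nbij (fun z => z.1 ++ z.2) ?_ ?_ ?_ ?_
  · rintro ⟨s, t⟩ h
    simp only [Finset.mem_sigma, Set.Finite.mem_toFinset] at h
    simpa using (growthSet_concat C c w (s ++ t)).2 ⟨s, h.1, t, h.2, rfl⟩
  · rintro ⟨s, t⟩ h ⟨s', t'⟩ h' e
    simp only [Finset.coe_sigma, Set.mem_sigma_iff, SetLike.mem_coe,
      Set.Finite.mem_toFinset] at h h'
    have hl : s.length = s'.length := by
      rw [← List.length_map (f := Prod.snd), ← List.length_map (f := Prod.snd) (as := s'),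
        map_snd_of_mem_growthSet h.1, map_snd_of_mem_growthSet h'.1]
    obtain ⟨rfl, rfl⟩ := List.append_inj e hl
    rfl
  · intro s hs
    obtain ⟨s₁, h1, t, h2, rfl⟩ := (growthSet_concat C c w s).1 (by simpa using hs)
    exact ⟨⟨s₁, t⟩, by simpa using ⟨h1, h2⟩, rfl⟩
  · rintro ⟨s, t⟩ -
    rw [build_append]

/-- The ribbon functions are sums of immaculate functions over growth sequences. -/
theorem R_eq_sum_growthSet (C : Sentence A) :
    R C = ∑ s ∈ (finite_growthSet C).toFinset, immaculate (build [] s) := by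
  induction hn : C.length using Nat.strong_induction_on generalizing C with
  | _ n ih =>
  subst hn
  rcases List.eq_nil_or_concat C with rfl | ⟨C, w, rfl⟩
  · have : (finite_growthSet ([] : Sentence A)).toFinset = {[]} := by
      ext s; simp [growthSet_nil]
    rw [this, Finset.sum_singleton, R_nil]
    rfl
  rw [List.concat_eq_append] at ih ⊢
  rcases List.eq_nil_or_concat C with rfl | ⟨C, c, rfl⟩
  · have : (finite_growthSet [w]).toFinset = (finite_stripSet [] w.1).toFinset := by
      ext s; simp [growthSet_singleton]
    rw [List.nil_append, this, ← immaculate_mul_hWord, R_singleton, hWord_of_ne w.2]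
    exact (one_mul _).symm
  · rw [List.concat_eq_append] at ih ⊢
    have h := R_concat_mul_H C c w
    rw [ih _ (by simp) (C ++ [c]) rfl, sum_growthSet_mul_H,
      ih _ (by simp) (C ++ [cat c w]) rfl] at h
    exact (add_right_cancel h).symm


/-! ### Rows of a diagram -/

/-- The `i`-th word of `J`, or the empty word if there is none. -/
def rowWord (J : Sentence A) (i : ℕ) : List A := (J[i]?.map Subtype.val).getD []

theorem rowWord_push {J : Sentence A} {r : ℕ} (h : r ≤ J.length) (a : A) (i : ℕ) :
    rowWord (push J r a) i = rowWord J i ++ if r = i then [a] else [] := by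
  induction J generalizing r i with
  | nil =>
    obtain rfl : r = 0 := by simpa using h
    cases i <;> simp [push, rowWord]
  | cons v J ih =>
    cases r with
    | zero => cases i <;> simp [push, rowWord]
    | succ r =>
      cases i with
      | zero => simp [push, rowWord]
      | succ i => simpa [push, rowWord] using ih (Nat.le_of_succ_le_succ h) i

theorem lt_length_push_iff {J : Sentence A} {r : ℕ} (h : r ≤ J.length) (a : A) (i : ℕ) :
    i < (push J r a).length ↔ i < J.length ∨ i = r := by
  induction J generalizing r i with
  | nil =>
    obtain rfl : r = 0 := by simpa using h
    simp [push]
  | cons v J ih =>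
    cases r with
    | zero => simp [push]; omega
    | succ r =>
      cases i with
      | zero => simp [push]
      | succ i => simpa [push] using ih (Nat.le_of_succ_le_succ h) i

theorem rowWord_build {J : Sentence A} {s : List (ℕ × A)} (h : Adm J s) (i : ℕ) :
    rowWord (build J s) i = rowWord J i ++ (s.filter fun x => x.1 = i).map Prod.snd := by
  induction s generalizing J with
  | nil => simp
  | cons x s ih =>
    rw [build_cons, ih h.2, rowWord_push h.1]
    by_cases hx : x.1 = i <;> simp [hx]

theorem eq_of_rowWord_eq {J J' : Sentence A} (h : ∀ i, rowWord J i = rowWord J' i) : J = J' := by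
  refine List.ext_getElem? fun i => ?_
  have hi := h i
  unfold rowWord at hi
  cases h1 : J[i]? with
  | none =>
    cases h2 : J'[i]? with
    | none => rfl
    | some v =>
      rw [h1, h2] at hi
      exact absurd hi.symm v.2
  | some u =>
    cases h2 : J'[i]? with
    | none =>
      rw [h1, h2] at hi
      exact absurd hi u.2
    | some v =>
      rw [h1, h2] at hi
      exact congrArg some (Subtype.ext hi)

/-- No row is skipped if and only if, before each box, all the rows above it are non-empty. -/
theorem adm_iff {J : Sentence A} {s : List (ℕ × A)} :
    Adm J s ↔ ∀ s₁ x s₂, s = s₁ ++ x :: s₂ → ∀ i < x.1, i < J.length ∨ i ∈ s₁.map Prod.fst := by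
  induction s generalizing J with
  | nil => simp [Adm]
  | cons y s ih =>
    rw [Adm, ih]
    constructor
    · rintro ⟨h1, h2⟩ s₁ x s₂ hs i hi
      cases s₁ with
      | nil =>
        obtain ⟨rfl, rfl⟩ := List.cons.inj hs
        exact Or.inl (hi.trans_le h1)
      | cons z s₁ =>
        obtain ⟨rfl, hs'⟩ := List.cons.inj hs
        have := h2 s₁ x s₂ hs' i hi
        rw [lt_length_push_iff h1] at this
        rw [List.map_cons, List.mem_cons, ← or_assoc]
        exact this
    · intro h
      have h1 : y.1 ≤ J.length := by
        by_contra! h1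
        simpa using h [] y s rfl _ h1
      refine ⟨h1, fun s₁ x s₂ hs i hi => ?_⟩
      have := h (y :: s₁) x s₂ (by rw [hs]; rfl) i hi
      rwa [List.map_cons, List.mem_cons, ← or_assoc, ← lt_length_push_iff h1 y.2] at this

/-! ### Standard tableaux as growth sequences -/

/-- The row and the color of a box. -/
def boxStep {J : Sentence A} (c : Box J) : ℕ × A := (c.1, c.color)

/-- The boxes in row `i`, from left to right. -/
def boxRow (J : Sentence A) (i : ℕ) : List (Box J) :=
  if h : i < J.length then List.ofFn fun j => ⟨⟨i, h⟩, j⟩ else []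

theorem mem_boxRow {J : Sentence A} {i : ℕ} {c : Box J} : c ∈ boxRow J i ↔ c.1.1 = i := by
  rcases c with ⟨⟨r, hr⟩, j⟩
  unfold boxRow
  split_ifs with h
  · rw [List.mem_ofFn', Set.mem_range]
    constructor
    · rintro ⟨j', h'⟩
      exact (congrArg (fun c : Box J => c.1.1) h').symm
    · rintro rfl
      exact ⟨j, rfl⟩
  · simp only [List.not_mem_nil, false_iff]
    rintro rfl
    exact h hr

theorem map_color_boxRow (J : Sentence A) (i : ℕ) :
    (boxRow J i).map Box.color = rowWord J i := by
  unfold boxRow rowWord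
  split_ifs with h
  · rw [List.map_ofFn, List.getElem?_eq_getElem h]
    exact List.ofFn_get (J[i]).1
  · simp [List.getElem?_eq_none (not_lt.1 h)]

theorem pairwise_boxRow {J : Sentence A} {f : Box J → ℕ} :
    (∀ i, (boxRow J i).Pairwise fun c d => f c < f d) ↔
      ∀ c d : Box J, c.1 = d.1 → (c.2 : ℕ) < (d.2 : ℕ) → f c < f d := by
  constructor
  · rintro h ⟨⟨i, hi⟩, j⟩ ⟨i', k⟩ h1 h2
    obtain rfl : ⟨i, hi⟩ = i' := h1
    have := h i
    rw [boxRow, dif_pos hi, List.pairwise_ofFn] at this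
    exact this h2
  · intro h i
    unfold boxRow
    split_ifs with hi
    · rw [List.pairwise_ofFn]
      exact fun j k hjk => h _ _ rfl hjk
    · exact List.Pairwise.nil

theorem card_box (J : Sentence A) : Fintype.card (Box J) = size J := by
  rw [Fintype.card_sigma]
  simp only [Fintype.card_fin, size]
  exact Fin.sum_univ_fun_getElem J fun w => w.1.length

/-- A list is determined by the classes of its elements and by its sublists of elements of a given
class. -/
theorem eq_of_filter_eq {β : Type*} (f : β → ℕ) {l l' : List β} (h : l.map f = l'.map f)
    (hf : ∀ i, l.filter (fun c => f c = i) = l'.filter fun c => f c = i) : l = l' := by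
  induction l generalizing l' with
  | nil => simpa using h.symm
  | cons c l ih =>
    cases l' with
    | nil => simp at h
    | cons c' l' =>
      obtain ⟨h1, h2⟩ := List.cons.inj (h : f c :: l.map f = f c' :: l'.map f)
      have hc := hf (f c)
      rw [List.filter_cons_of_pos (by simp), List.filter_cons_of_pos (by simp [h1])] at hc
      obtain ⟨rfl, hc'⟩ := List.cons.inj hc
      rw [ih h2 fun i => ?_]
      by_cases hi : f c = i
      · subst hi
        exact hc'
      · simpa [List.filter_cons, hi] using hf i

/-- Lists that project to the classes of a list can be shuffled into a list over it. -/
theorem exists_list_of_filter_eq {α β : Type*} (g : α → ℕ) (f : β → α) (s : List α)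
    (m : ℕ → List β) (h : ∀ i, s.filter (fun x => g x = i) = (m i).map f) :
    ∃ l : List β, l.map f = s ∧ ∀ i, l.filter (fun c => g (f c) = i) = m i := by
  induction s generalizing m with
  | nil =>
    refine ⟨[], rfl, fun i => ?_⟩
    simpa using h i
  | cons x s ih =>
    have hx := h (g x)
    rw [List.filter_cons_of_pos (by simp)] at hx
    obtain ⟨c, m', hm, hc, hm'⟩ := List.map_eq_cons_iff.1 hx.symm
    obtain ⟨l, rfl, hl⟩ := ih (Function.update m (g x) m') fun i => by
      by_cases hi : g x = i
      · subst hi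
        rw [Function.update_self, hm']
      · rw [Function.update_of_ne (Ne.symm hi), ← h i, List.filter_cons_of_neg (by simpa using hi)]
    refine ⟨c :: l, by rw [List.map_cons, hc], fun i => ?_⟩
    by_cases hi : g x = i
    · subst hi
      rw [List.filter_cons_of_pos (by simp [hc]), hl, Function.update_self, hm]
    · rw [List.filter_cons_of_neg (by simpa [hc] using hi), hl, Function.update_of_ne (Ne.symm hi)]

theorem splitBy_map {α β : Type*} (f : α → β) (r : β → β → Bool) (l : List α) :
    (l.map f).splitBy r = (l.splitBy fun x y => r (f x) (f y)).map (List.map f) := by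
  rw [List.splitBy_eq_iff]
  refine ⟨?_, ?_, ?_, ?_⟩
  · rw [← List.map_flatten, List.flatten_splitBy]
  · simp
  · intro m hm
    obtain ⟨m, hm', rfl⟩ := List.mem_map.1 hm
    rw [List.isChain_map]
    exact List.isChain_of_mem_splitBy hm'
  · rw [List.isChain_map]
    refine (List.isChain_getLast_head_splitBy (fun x y => r (f x) (f y)) l).imp ?_
    rintro x y ⟨hx, hy, h⟩
    exact ⟨by simpa using hx, by simpa using hy, by simpa using h⟩

namespace SCIT

variable {J : Sentence A} (T : SCIT J)

theorem entry_box (k : Fin (size J)) : T.entry (T.box k) = k + 1 :=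
  (T.standard (k + 1) (by omega) (by omega)).exists.choose_spec

theorem box_injective : Function.Injective T.box := fun k k' h => by
  have := T.entry_box k
  rw [h, T.entry_box] at this
  exact Fin.ext (by omega)

theorem box_surjective : Function.Surjective T.box :=
  ((Fintype.bijective_iff_injective_and_card T.box).2
    ⟨T.box_injective, by rw [Fintype.card_fin, card_box]⟩).2

theorem entry_injective : Function.Injective T.entry := fun c d h => by
  obtain ⟨k, rfl⟩ := T.box_surjective c
  obtain ⟨k', rfl⟩ := T.box_surjective d
  rw [T.entry_box, T.entry_box] at h
  rw [Fin.ext (Nat.succ_injective h)]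

theorem box_eq_of_entry {k : Fin (size J)} {c : Box J} (h : T.entry c = k + 1) : T.box k = c :=
  T.entry_injective ((T.entry_box k).trans h.symm)

theorem ext_box {T T' : SCIT J} (h : T.box = T'.box) : T = T' := by
  have : T.entry = T'.entry := by
    funext c
    obtain ⟨k, rfl⟩ := T.box_surjective c
    rw [T.entry_box, h, T'.entry_box]
  rcases T with ⟨⟨e, _, _, _⟩, _⟩
  rcases T' with ⟨⟨e', _, _, _⟩, _⟩
  obtain rfl : e = e' := this
  rfl

/-- The rows and colors of the boxes in the order in which they are numbered. -/
noncomputable def growth : List (ℕ × A) := (List.ofFn T.box).map boxStep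

theorem pairwise_ofFn_box : (List.ofFn T.box).Pairwise fun c d => T.entry c < T.entry d := by
  rw [List.pairwise_ofFn]
  intro k k' h
  rw [T.entry_box, T.entry_box]
  exact Nat.succ_lt_succ h

/-- The boxes of row `i` are numbered from left to right. -/
theorem filter_ofFn_box (i : ℕ) :
    (List.ofFn T.box).filter (fun c => (boxStep c).1 = i) = boxRow J i := by
  have hp : (boxRow J i).Pairwise fun c d => T.entry c < T.entry d := by
    refine pairwise_boxRow.2 (fun c d h1 h2 => ?_) i
    refine (T.row_weak c d h1 h2.le).lt_of_ne fun h => ?_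
    rw [T.entry_injective h] at h2
    exact lt_irrefl _ h2
  have hq := T.pairwise_ofFn_box.filter fun c => decide ((boxStep c).1 = i)
  refine List.map_injective_iff.2 T.entry_injective ?_
  refine List.SortedLT.eq_of_mem_iff (List.sortedLT_iff_pairwise.2 (List.pairwise_map.2 hq))
    (List.sortedLT_iff_pairwise.2 (List.pairwise_map.2 hp)) fun n => ?_
  have : ∀ c, c ∈ (List.ofFn T.box).filter (fun c => (boxStep c).1 = i) ↔ c ∈ boxRow J i := by
    intro c
    rw [mem_boxRow, List.mem_filter, List.mem_ofFn']
    exact ⟨fun h => of_decide_eq_true h.2, fun h => ⟨T.box_surjective c, decide_eq_true h⟩⟩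
  simp only [List.mem_map, this]

/-- The first column increases, so a row is only started after all rows above it. -/
theorem adm_growth : Adm [] T.growth := by
  rw [adm_iff]
  intro s₁ x s₂ h i hi
  right
  obtain ⟨l₁, l₂, hl, rfl, h2⟩ := List.map_eq_append_iff.1 h
  obtain ⟨c, l₃, rfl, rfl, rfl⟩ := List.map_eq_cons_iff.1 h2
  have hi' : i < c.1.1 := hi
  have hJ : i < J.length := hi'.trans c.1.2
  set d : Box J := ⟨⟨i, hJ⟩, ⟨0, List.length_pos_of_ne_nil (J.get ⟨i, hJ⟩).2⟩⟩ with hd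
  have hlt : T.entry d < T.entry c := by
    have h0 := List.length_pos_of_ne_nil (J.get c.1).2
    exact (T.col_strict d ⟨c.1, ⟨0, h0⟩⟩ rfl rfl hi').trans_le (T.row_weak _ _ rfl (Nat.zero_le _))
  have hp := T.pairwise_ofFn_box
  have hm : d ∈ List.ofFn T.box := (List.mem_ofFn' _ _).2 (T.box_surjective d)
  rw [hl] at hp hm
  rcases List.mem_append.1 hm with hm | hm
  · rw [List.map_map]
    exact List.mem_map.2 ⟨d, hm, rfl⟩
  · rcases List.mem_cons.1 hm with rfl | hm
    · exact absurd hlt (lt_irrefl _)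
    · exact absurd hlt ((List.pairwise_cons.1 (List.pairwise_append.1 hp).2.1).1 d hm).not_gt

theorem build_growth : build [] T.growth = J := by
  refine eq_of_rowWord_eq fun i => ?_
  rw [rowWord_build T.adm_growth, growth, List.filter_map, List.map_map]
  exact (congrArg (List.map Box.color) (T.filter_ofFn_box i)).trans (map_color_boxRow J i)

theorem descWords_growth : descWords T.growth = T.descentComposition.map Subtype.val := by
  rw [descWords, growth, splitBy_map, List.map_map, descentComposition, List.map_map]
  simp only [blocks, boxStep, Fin.val_fin_le]
  refine List.ext_getElem (by simp) fun n h1 h2 => ?_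
  simp [boxStep]

theorem growth_injective : Function.Injective (growth : SCIT J → List (ℕ × A)) := fun T T' h => by
  refine ext_box (List.ofFn_injective (eq_of_filter_eq (fun c : Box J => (boxStep c).1) ?_ ?_))
  · simpa [growth, List.map_map, Function.comp_def] using congrArg (List.map Prod.fst) h
  · intro i
    rw [T.filter_ofFn_box, T'.filter_ofFn_box]

end SCIT

/-- Every growth sequence `s` comes from a tableau: its entries `1, 2, …` are put, one after the
other, into the leftmost free box of the row prescribed by `s`. -/
theorem exists_growth_eq {J : Sentence A} {s : List (ℕ × A)} (hA : Adm [] s)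
    (hJ : build [] s = J) : ∃ T : SCIT J, T.growth = s := by
  classical
  -- `l` lists the boxes in the order in which they are to be numbered
  obtain ⟨l, rfl, hl⟩ := exists_list_of_filter_eq Prod.fst (boxStep (J := J)) s (boxRow J) (by
    intro i
    have h := rowWord_build hA i
    rw [hJ, ← map_color_boxRow] at h
    have h1 : ∀ l : List (ℕ × A), (∀ x ∈ l, x.1 = i) →
        l = (l.map Prod.snd).map fun a => (i, a) := by
      intro l hl
      rw [List.map_map]
      refine (List.map_id l).symm.trans ?_
      exact List.map_congr_left fun x hx => Prod.ext (hl x hx) rfl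
    rw [h1 (s.filter fun x => x.1 = i) fun x hx => by simpa using (List.mem_filter.1 hx).2,
      h1 ((boxRow J i).map boxStep) fun x hx => ?_, List.map_map (l := boxRow J i)]
    · congr 1
      have hr : rowWord ([] : Sentence A) i = [] := rfl
      rw [hr, List.nil_append] at h
      exact h.symm
    · obtain ⟨c, hc, rfl⟩ := List.mem_map.1 hx
      exact mem_boxRow.1 hc)
  have hmem : ∀ c, c ∈ l := fun c => by
    have : c ∈ boxRow J c.1 := mem_boxRow.2 rfl
    rw [← hl] at this
    exact (List.mem_filter.1 this).1
  have hnd : l.Nodup := by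
    rw [List.nodup_iff_count_le_one]
    intro c
    have : (boxRow J c.1).Nodup := by
      unfold boxRow
      rw [dif_pos c.1.2, List.nodup_ofFn]
      intro j k h
      simpa using h
    have := List.nodup_iff_count_le_one.1 this c
    rwa [← hl, List.count_filter (by simp [boxStep])] at this
  have hlen : l.length = size J := by
    rw [← card_box, ← List.toFinset_card_of_nodup hnd, ← Finset.card_univ]
    congr 1
    ext c
    simp [hmem]
  have hp : l.Pairwise fun c d => l.idxOf c < l.idxOf d := by
    rw [List.pairwise_iff_getElem]
    intro i j hi hj hij
    rwa [hnd.idxOf_getElem, hnd.idxOf_getElem]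
  have hrow : ∀ c d : Box J, c.1 = d.1 → (c.2 : ℕ) < (d.2 : ℕ) → l.idxOf c < l.idxOf d := by
    refine pairwise_boxRow.1 fun i => ?_
    rw [← hl]
    exact hp.filter _
  have hrow' : ∀ c d : Box J, c.1 = d.1 → (c.2 : ℕ) ≤ (d.2 : ℕ) → l.idxOf c ≤ l.idxOf d := by
    rintro ⟨i, j⟩ ⟨i', j'⟩ h1 h2
    obtain rfl : i = i' := h1
    rcases h2.lt_or_eq with h2 | h2
    · exact (hrow ⟨i, j⟩ ⟨i, j'⟩ rfl h2).le
    · obtain rfl : j = j' := Fin.ext h2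
      exact le_rfl
  let T : SCIT J :=
    { entry := fun c => l.idxOf c + 1
      entry_pos := fun c => Nat.succ_pos _
      row_weak := fun c d h1 h2 => Nat.succ_le_succ (hrow' c d h1 h2)
      col_strict := by
        intro c d hc hd hcd
        refine Nat.succ_lt_succ ?_
        obtain ⟨l₁, l₂, h⟩ := List.append_of_mem (hmem d)
        have h' := adm_iff.1 hA (l₁.map boxStep) (boxStep d) (l₂.map boxStep)
          (by rw [h]; simp) c.1 hcd
        obtain ⟨x, hx, hxc⟩ := List.mem_map.1 (h'.resolve_left (by simp))
        obtain ⟨e, he, rfl⟩ := List.mem_map.1 hx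
        refine (hrow' c e (Fin.ext hxc.symm) (by rw [hc]; exact Nat.zero_le _)).trans_lt ?_
        have hp' := hp
        rw [h] at hp'
        have := (List.pairwise_append.1 hp').2.2 e he d (by simp)
        rwa [← h] at this
      standard := by
        intro k h1 h2
        have hk : k - 1 < l.length := by omega
        refine ⟨l[k - 1], ?_, fun c hc => ?_⟩
        · change l.idxOf l[k - 1] + 1 = k
          rw [hnd.idxOf_getElem]
          omega
        · have hc : l.idxOf c + 1 = k := hc
          have : l.idxOf c = k - 1 := by omega
          simp [← this] }
  refine ⟨T, congrArg (List.map boxStep) (List.ext_getElem (by simp [hlen]) fun n h1 h2 => ?_)⟩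
  rw [List.getElem_ofFn]
  refine T.box_eq_of_entry ?_
  change l.idxOf l[n] + 1 = n + 1
  rw [hnd.idxOf_getElem]

theorem SCIT.growth_mem_growthSet_iff {J C : Sentence A} (T : SCIT J) :
    T.growth ∈ growthSet C ↔ T.descentComposition = C := by
  rw [growthSet, Set.mem_ofPred_eq, T.descWords_growth,
    (List.map_injective_iff.2 Subtype.val_injective).eq_iff]
  exact and_iff_right T.adm_growth

/-- `L_{J,C}` counts the growth sequences of shape `J` with descent composition `C`. -/
theorem L_eq_card (J C : Sentence A) :
    L J C = Nat.card {s : List (ℕ × A) // s ∈ growthSet C ∧ build [] s = J} := by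
  refine Nat.card_congr (Equiv.ofBijective
    (fun T => ⟨T.1.growth, T.1.growth_mem_growthSet_iff.2 T.2, T.1.build_growth⟩) ⟨?_, ?_⟩)
  · intro T T' h
    exact Subtype.ext (SCIT.growth_injective (congrArg Subtype.val h))
  · rintro ⟨s, hs, hJ⟩
    obtain ⟨T, rfl⟩ := exists_growth_eq hs.1 hJ
    exact ⟨⟨T, T.growth_mem_growthSet_iff.1 hs⟩, rfl⟩


/-! ### Triangularity of the matrix `L` -/

/-- The sum of the row numbers of the boxes of a diagram whose rows, numbered from `h`, are the
words of the given list. -/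
def rowWeight : ℕ → List (List A) → ℕ
  | _, [] => 0
  | h, c :: C => h * c.length + rowWeight (h + 1) C

/-- The sum of the row numbers of the boxes of the diagram of `J`. -/
def weight (J : Sentence A) : ℕ := rowWeight 0 (J.map Subtype.val)

theorem rowWeight_push {J : Sentence A} {r : ℕ} (hr : r ≤ J.length) (a : A) (h : ℕ) :
    rowWeight h ((push J r a).map Subtype.val) = rowWeight h (J.map Subtype.val) + (h + r) := by
  induction J generalizing r h with
  | nil =>
    obtain rfl : r = 0 := by simpa using hr
    simp [push, rowWeight]
  | cons v J ih =>
    cases r with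
    | zero => simp [push, rowWeight]; ring
    | succ r =>
      simp only [push, List.map_cons, rowWeight, ih (Nat.le_of_succ_le_succ hr)]
      ring

theorem weight_build {J : Sentence A} {s : List (ℕ × A)} (h : Adm J s) :
    weight (build J s) = weight J + (s.map Prod.fst).sum := by
  induction s generalizing J with
  | nil => simp
  | cons x s ih =>
    rw [build_cons, ih h.2, weight, rowWeight_push h.1, List.map_cons, List.sum_cons, weight]
    ring

theorem length_build_le {J : Sentence A} {s : List (ℕ × A)} {h : ℕ} (hA : Adm J s)
    (hs : ∀ x ∈ s, x.1 ≤ h) (hJ : J.length ≤ h + 1) : (build J s).length ≤ h + 1 := by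
  induction s generalizing J with
  | nil => exact hJ
  | cons x s ih =>
    refine ih hA.2 (fun y hy => hs y (List.mem_cons_of_mem _ hy)) ?_
    by_contra! hlt
    have := hs x List.mem_cons_self
    rcases (lt_length_push_iff hA.1 _ _).1 hlt with h' | h' <;> omega

theorem sum_fst_le {s : List (ℕ × A)} {h : ℕ} (hs : ∀ x ∈ s, x.1 ≤ h) :
    (s.map Prod.fst).sum ≤ h * s.length ∧
      ((s.map Prod.fst).sum = h * s.length → s = (s.map Prod.snd).map fun a => (h, a)) := by
  induction s with
  | nil => simp
  | cons x s ih =>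
    obtain ⟨h1, h2⟩ := ih fun y hy => hs y (List.mem_cons_of_mem _ hy)
    have hx := hs x List.mem_cons_self
    simp only [List.map_cons, List.sum_cons, List.length_cons, Nat.mul_succ]
    refine ⟨by omega, fun h' => ?_⟩
    rw [← h2 (by omega)]
    exact congrArg (· :: s) (Prod.ext (by simp only; omega) rfl)

/-- The growth sequence that fills the rows one after the other, cut into its rows; the rows are
numbered from `h`. -/
def rowByRow : ℕ → List (List A) → List (List (ℕ × A))
  | _, [] => []
  | h, c :: C => c.map (fun a => (h, a)) :: rowByRow (h + 1) C

/-- If the starting shape has at most `h` rows, the boxes of the `t`-th run (counted from `0`) lie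
in the rows up to `h + t`, because a run can only start a new row with its first box; in the extreme
case the sequence fills the rows one after the other. -/
theorem sum_fst_flatten_le {B : List (List (ℕ × A))} {J : Sentence A} {h : ℕ}
    (hn : [] ∉ B) (hp : ∀ g ∈ B, g.Pairwise RowGE) (hA : Adm J B.flatten) (hJ : J.length ≤ h) :
    (B.flatten.map Prod.fst).sum ≤ rowWeight h (B.map (List.map Prod.snd)) ∧
      ((B.flatten.map Prod.fst).sum = rowWeight h (B.map (List.map Prod.snd)) →
        B = rowByRow h (B.map (List.map Prod.snd))) := by
  induction B generalizing J h with
  | nil => simp [rowWeight, rowByRow]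
  | cons g B ih =>
    rw [List.flatten_cons] at hA
    obtain ⟨hA1, hA2⟩ := adm_append.1 hA
    have hg : ∀ x ∈ g, x.1 ≤ h := by
      intro x hx
      cases g with
      | nil => simp at hx
      | cons y g =>
        have hy : y.1 ≤ h := hA1.1.trans hJ
        rcases List.mem_cons.1 hx with rfl | hx
        · exact hy
        · exact ((List.pairwise_cons.1 (hp _ List.mem_cons_self)).1 x hx).trans hy
    obtain ⟨h1, h2⟩ := ih (fun h' => hn (List.mem_cons_of_mem _ h'))
      (fun k hk => hp k (List.mem_cons_of_mem _ hk)) hA2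
      (length_build_le hA1 hg (hJ.trans (Nat.le_succ h)))
    obtain ⟨h3, h4⟩ := sum_fst_le hg
    simp only [List.flatten_cons, List.map_append, List.sum_append, List.map_cons, rowWeight,
      rowByRow, List.length_map]
    refine ⟨by omega, fun h' => ?_⟩
    rw [← h4 (by omega), ← h2 (by omega)]

theorem build_lastRow (J : Sentence A) (c : NWord A) :
    build J (c.1.map fun a => (J.length, a)) = J ++ [c] := by
  induction J with
  | nil => exact build_nil_map_zero c.2
  | cons v J ih =>
    have := build_map_succ v J (c.1.map fun a => (J.length, a))
    rw [List.map_map, ih] at this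
    exact this

theorem adm_lastRow (J : Sentence A) (c : NWord A) :
    Adm J (c.1.map fun a => (J.length, a)) := by
  induction J with
  | nil => exact adm_map_zero _ _
  | cons v J ih =>
    have := (adm_map_succ (v := v)).2 ih
    rwa [List.map_map] at this

theorem build_rowByRow (J C : Sentence A) :
    Adm J (rowByRow J.length (C.map Subtype.val)).flatten ∧
      build J (rowByRow J.length (C.map Subtype.val)).flatten = J ++ C := by
  induction C generalizing J with
  | nil => simp [rowByRow, Adm]
  | cons c C ih =>
    have h := ih (J ++ [c])
    rw [List.length_append, List.length_singleton] at h
    rw [List.map_cons, rowByRow, List.flatten_cons, adm_append, build_append, build_lastRow]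
    exact ⟨⟨adm_lastRow J c, h.1⟩, by rw [h.2]; simp⟩

theorem map_snd_rowByRow (h : ℕ) (C : List (List A)) :
    (rowByRow h C).map (List.map Prod.snd) = C := by
  induction C generalizing h with
  | nil => rfl
  | cons c C ih => simp [rowByRow, ih, Function.comp_def]

theorem isRuns_rowByRow (h : ℕ) (C : Sentence A) : IsRuns (rowByRow h (C.map Subtype.val)) := by
  induction C generalizing h with
  | nil => exact ⟨by simp [rowByRow], by simp [rowByRow], by simp [rowByRow]⟩
  | cons c C ih =>
    obtain ⟨h1, h2, h3⟩ := ih (h + 1)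
    refine ⟨?_, ?_, ?_⟩
    · simp only [List.map_cons, rowByRow, List.mem_cons, not_or]
      exact ⟨by simp [c.2], h1⟩
    · intro g hg
      rcases List.mem_cons.1 hg with rfl | hg
      · rw [List.pairwise_map]
        exact List.pairwise_of_forall fun _ _ => le_rfl
      · exact h2 g hg
    · simp only [List.map_cons, rowByRow]
      rw [List.isChain_cons]
      refine ⟨fun y hy => ?_, h3⟩
      cases C with
      | nil => simp [rowByRow] at hy
      | cons d C =>
        obtain rfl : d.1.map (fun a => (h + 1, a)) = y := by simpa [rowByRow] using hy
        exact ⟨by simpa using c.2, by simpa using d.2, by simp⟩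

/-- The weight is monotone from the shape to the descent composition, and a growth sequence for
which the two weights agree is determined by its descent composition. -/
theorem growthSet_weight {C : Sentence A} {s : List (ℕ × A)} (hs : s ∈ growthSet C) :
    weight (build [] s) ≤ weight C ∧ (weight (build [] s) = weight C →
      s = (rowByRow 0 (C.map Subtype.val)).flatten) := by
  obtain ⟨hA, hd⟩ := hs
  obtain ⟨B, rfl, hB, h⟩ := descWords_eq_iff.1 hd
  have hw := weight_build hA
  have := sum_fst_flatten_le hB.nil_notMem hB.pairwise hA (le_refl 0)
  rw [h] at this
  have h0 : weight ([] : Sentence A) = 0 := rfl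
  rw [h0, zero_add] at hw
  rw [hw]
  exact ⟨this.1, fun h' => congrArg List.flatten (this.2 h')⟩

theorem SCIT.weight_le {J : Sentence A} (T : SCIT J) : weight J ≤ weight T.descentComposition := by
  have := (growthSet_weight (T.growth_mem_growthSet_iff.2 rfl)).1
  rwa [T.build_growth] at this

theorem SCIT.eq_of_weight_eq {J : Sentence A} (T : SCIT J)
    (h : weight J = weight T.descentComposition) : J = T.descentComposition := by
  have := (growthSet_weight (T.growth_mem_growthSet_iff.2 rfl)).2
  rw [T.build_growth] at this
  have h2 := (build_rowByRow [] T.descentComposition).2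
  rw [List.length_nil, ← this h, T.build_growth] at h2
  exact h2

theorem L_self (J : Sentence A) : L J J = 1 := by
  rw [L_eq_card, Nat.card_eq_one_iff_unique]
  constructor
  · refine ⟨fun ⟨s, hs, h⟩ ⟨s', hs', h'⟩ => Subtype.ext ?_⟩
    exact ((growthSet_weight hs).2 (congrArg weight h)).trans
      ((growthSet_weight hs').2 (congrArg weight h')).symm
  · have h := build_rowByRow [] J
    exact ⟨⟨(rowByRow 0 (J.map Subtype.val)).flatten, ⟨h.1, descWords_eq_iff.2
      ⟨_, rfl, isRuns_rowByRow 0 J, map_snd_rowByRow _ _⟩⟩, h.2⟩⟩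

theorem weight_lt_of_adj {n : ℕ} {I J : SentenceOf A n} (h : (descentGraph A n).Adj I J) :
    weight I.1 < weight J.1 := by
  obtain ⟨hne, T, hT⟩ := h
  rw [← hT]
  exact T.weight_le.lt_of_ne fun h => hne (Subtype.ext ((T.eq_of_weight_eq h).trans hT))

theorem L_eq_zero_of_not_adj {n : ℕ} {I J : SentenceOf A n} (hne : I ≠ J)
    (h : ¬(descentGraph A n).Adj I J) : L I.1 J.1 = 0 := by
  have : IsEmpty {T : SCIT I.1 // T.descentComposition = J.1} :=
    ⟨fun T => h ⟨hne, T.1, T.2⟩⟩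
  exact Nat.card_of_isEmpty

/-! ### Paths in the descent graph -/

theorem weight_le_of_isChain {n : ℕ} {K : SentenceOf A n} {q : List (SentenceOf A n)}
    (h : (K :: q).IsChain (descentGraph A n).Adj) : ∀ x ∈ K :: q, weight K.1 ≤ weight x.1 := by
  induction q generalizing K with
  | nil => simp
  | cons y q ih =>
    obtain ⟨h1, h2⟩ := List.isChain_cons_cons.1 h
    intro x hx
    rcases List.mem_cons.1 hx with rfl | hx
    · exact le_rfl
    · exact (weight_lt_of_adj h1).le.trans (ih h2 x hx)

/-- A path is empty or consists of a first edge and a path from its head; the starting point is not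
visited again because edges increase the weight. -/
theorem isPath_iff {n : ℕ} {I J : SentenceOf A n} {p : List (SentenceOf A n)} :
    IsPath I J p ↔ (I = J ∧ p = [I]) ∨
      ∃ K, (descentGraph A n).Adj I K ∧ ∃ q, IsPath K J q ∧ I :: q = p := by
  constructor
  · rintro ⟨h1, h2, h3, h4⟩
    rcases p with _ | ⟨x, _ | ⟨K, q⟩⟩
    · simp at h3
    · obtain rfl : x = I := by simpa using h3
      obtain rfl : x = J := by simpa using h4
      exact Or.inl ⟨rfl, rfl⟩
    · obtain rfl : x = I := by simpa using h3
      obtain ⟨h5, h6⟩ := List.isChain_cons_cons.1 h1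
      exact Or.inr ⟨K, h5, K :: q, ⟨h6, h2.of_cons, rfl, by simpa using h4⟩, rfl⟩
  · rintro (⟨rfl, rfl⟩ | ⟨K, hK, q, ⟨h1, h2, h3, h4⟩, rfl⟩)
    · exact ⟨by simp, by simp, rfl, rfl⟩
    · rcases q with _ | ⟨x, q⟩
      · simp at h3
      · obtain rfl : x = K := by simpa using h3
        refine ⟨List.isChain_cons_cons.2 ⟨hK, h1⟩, List.nodup_cons.2 ⟨fun hI => ?_, h2⟩, rfl, by
          simpa using h4⟩
        exact (weight_lt_of_adj hK).not_ge (weight_le_of_isChain h1 I hI)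

open Classical in
/-- Splitting off the first edge of a path. -/
theorem signedPathSum_eq [Finite A] {n : ℕ} (I J : SentenceOf A n) :
    signedPathSum I J = (if I = J then 1 else 0) -
      ∑ K with (descentGraph A n).Adj I K, (L I.1 K.1 : ℚ) * signedPathSum K J := by
  have hp : paths I J = (if I = J then {[I]} else ∅) ∪
      (Finset.univ.filter fun K => (descentGraph A n).Adj I K).biUnion
        fun K => (paths K J).image (List.cons I) := by
    ext p
    simp only [paths, Set.Finite.mem_toFinset, Set.mem_ofPred_eq, Finset.mem_union,
      Finset.mem_biUnion, Finset.mem_filter, Finset.mem_univ, true_and, Finset.mem_image,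
      isPath_iff (I := I)]
    refine or_congr_left ?_
    split_ifs with h <;> simp [h]
  have hmem : ∀ {K : SentenceOf A n} {q}, q ∈ paths K J → ∃ q', q = K :: q' := by
    intro K q hq
    have hq := ((finite_paths K J).mem_toFinset.1 hq).head_eq
    cases q with
    | nil => simp at hq
    | cons x q => exact ⟨q, by simpa using hq⟩
  have hd : Disjoint (if I = J then {[I]} else ∅)
      ((Finset.univ.filter fun K => (descentGraph A n).Adj I K).biUnion
        fun K => (paths K J).image (List.cons I)) := by
    split_ifs
    · rw [Finset.disjoint_singleton_left]
      intro h
      obtain ⟨K, -, h⟩ := Finset.mem_biUnion.1 h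
      obtain ⟨q, hq, h⟩ := Finset.mem_image.1 h
      obtain ⟨q', rfl⟩ := hmem hq
      simp at h
    · exact Finset.disjoint_empty_left _
  rw [signedPathSum, hp, Finset.sum_union hd, Finset.sum_biUnion, sub_eq_add_neg,
    ← Finset.sum_neg_distrib]
  · congr 1
    · split_ifs <;> simp [pathLength, pathProd]
    · refine Finset.sum_congr rfl fun K _ => ?_
      rw [Finset.sum_image (by simp), signedPathSum, Finset.mul_sum, ← Finset.sum_neg_distrib]
      refine Finset.sum_congr rfl fun q hq => ?_
      obtain ⟨q', rfl⟩ := hmem hq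
      simp [pathLength, pathProd, pow_succ]
      ring
  · intro K _ K' _ hne
    rw [Function.onFun, Finset.disjoint_left]
    intro p h h'
    obtain ⟨q, hq, rfl⟩ := Finset.mem_image.1 h
    obtain ⟨q', hq', h'⟩ := Finset.mem_image.1 h'
    obtain ⟨_, rfl⟩ := hmem hq
    obtain ⟨_, rfl⟩ := hmem hq'
    simp at h'
    exact hne h'.1.symm

theorem matL_mul_signedPathSum [Finite A] [DecidableEq A] (n : ℕ) :
    matL A n * Matrix.of (fun I J => signedPathSum I J) = 1 := by
  classical
  ext I J
  rw [Matrix.mul_apply, ← Finset.add_sum_erase _ _ (Finset.mem_univ I), Matrix.one_apply]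
  simp only [matL, Matrix.of_apply, L_self, Nat.cast_one, one_mul]
  rw [signedPathSum_eq I J, sub_add_eq_add_sub]
  have : ∑ K ∈ Finset.univ.erase I, (L I.1 K.1 : ℚ) * signedPathSum K J =
      ∑ K with (descentGraph A n).Adj I K, (L I.1 K.1 : ℚ) * signedPathSum K J := by
    symm
    refine Finset.sum_subset (fun K hK => ?_) fun K hK hK' => ?_
    · exact Finset.mem_erase.2 ⟨(Finset.mem_filter.1 hK).2.1.symm, Finset.mem_univ _⟩
    · rw [L_eq_zero_of_not_adj (Finset.mem_erase.1 hK).1.symm fun h => hK' (by simpa using h)]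
      simp
  rw [this, add_sub_cancel_right]
  congr 1

/-! ### The expansions -/

theorem size_push (J : Sentence A) (r : ℕ) (a : A) : size (push J r a) = size J + 1 := by
  induction J generalizing r with
  | nil => simp [push, size]
  | cons v J ih =>
    cases r with
    | zero => simp [push, size]; ring
    | succ r =>
      have := ih r
      simp only [size, push, List.map_cons, List.sum_cons] at this ⊢
      omega

theorem size_build (J : Sentence A) (s : List (ℕ × A)) : size (build J s) = size J + s.length := by
  induction s generalizing J with
  | nil => rfl
  | cons x s ih => rw [build_cons, ih, size_push, List.length_cons]; ring

theorem length_maxWord (C : Sentence A) : (maxWord C).length = size C := by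
  simp [maxWord, size, List.length_flatten]

/-- `R_C = ∑_J L_{J,C} 𝔖_J`, by grouping the growth sequences by their shape. -/
theorem R_eq_sum_matL [Finite A] (n : ℕ) (C : SentenceOf A n) :
    R C.1 = ∑ J : SentenceOf A n, matL A n J C • immaculate J.1 := by
  classical
  have hsize : ∀ s ∈ (finite_growthSet C.1).toFinset, size (build [] s) = n := by
    intro s hs
    rw [Set.Finite.mem_toFinset] at hs
    rw [size_build, ← List.length_map (f := Prod.snd), map_snd_of_mem_growthSet hs, length_maxWord,
      C.2]
    exact zero_add n
  rw [R_eq_sum_growthSet]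
  have : ∀ J : SentenceOf A n, matL A n J C • immaculate J.1 =
      ∑ s ∈ (finite_growthSet C.1).toFinset with build [] s = J.1, immaculate (build [] s) := by
    intro J
    rw [Finset.sum_congr rfl fun s hs => congrArg immaculate (Finset.mem_filter.1 hs).2,
      Finset.sum_const, matL, Matrix.of_apply, L_eq_card, ← Nat.cast_smul_eq_nsmul ℚ]
    congr 2
    exact Nat.subtype_card _ fun s => by simp
  simp_rw [this]
  rw [Finset.sum_comm'
    (s' := fun s => Finset.univ.filter fun J : SentenceOf A n => build [] s = J.1)
    (t' := (finite_growthSet C.1).toFinset) (by simp [and_comm])]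
  refine Finset.sum_congr rfl fun s hs => ?_
  rw [Finset.sum_eq_single ⟨build [] s, hsize s hs⟩]
  · exact fun J hJ hne => absurd (Subtype.ext (Finset.mem_filter.1 hJ).2.symm) hne
  · simp

end ColoredImm

theorem mainTheorem8 {A : Type*} [Finite A] [DecidableEq A] (n : ℕ) :
    -- the matrix `L` is invertible, and its inverse is given by signed sums over directed paths
    (IsUnit (ColoredImm.matL A n) ∧
      ∀ I J : ColoredImm.SentenceOf A n,
        (ColoredImm.matL A n)⁻¹ I J = ColoredImm.signedPathSum I J) ∧
    -- the expansion of colored immaculate functions into colored ribbon functions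
    (∀ J : ColoredImm.SentenceOf A n,
      ColoredImm.immaculate J.1 =
        ∑ I : ColoredImm.SentenceOf A n, (ColoredImm.matL A n)⁻¹ I J • ColoredImm.R I.1) ∧
    -- the expansion of colored ribbon functions into colored immaculate functions
    (∀ C : ColoredImm.SentenceOf A n,
      ColoredImm.R C.1 =
        ∑ J : ColoredImm.SentenceOf A n, ColoredImm.matL A n J C • ColoredImm.immaculate J.1) := by
  classical
  have hmul := ColoredImm.matL_mul_signedPathSum (A := A) n
  have hunit : IsUnit (ColoredImm.matL A n) := IsUnit.of_mul_eq_one _ hmul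
  refine ⟨⟨hunit, fun I J => ?_⟩, fun J => ?_, ColoredImm.R_eq_sum_matL n⟩
  · rw [Matrix.inv_eq_right_inv hmul, Matrix.of_apply]
  · have hinv := Matrix.mul_nonsing_inv _ ((Matrix.isUnit_iff_isUnit_det _).1 hunit)
    simp_rw [ColoredImm.R_eq_sum_matL, Finset.smul_sum, smul_smul]
    rw [Finset.sum_comm]
    simp_rw [← Finset.sum_smul, mul_comm _ (ColoredImm.matL A n _ _), ← Matrix.mul_apply, hinv,
      Matrix.one_apply]
    simp
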